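/- Let $d\in\mathbb N_0$ and let $$\mathcal O_M(\mathbb R^d)=\{f\in C^\infty(\mathbb R^d;\mathbb C):\ \forall\alpha\in\mathbb N_0^d\ \exists N\in\mathbb N:\ \langle x\rangle^{-N}\partial^\alpha f\in L^\infty(\mathbb R^d)\},\qquad \langle x\rangle=1+|x|^2,$$ be the space of slowly increasing functions. For $n,N\in\mathbb N_0$ let $X_{n,N}$ be the Banach space of all $f\in C^n(\mathbb R^d;\mathbb C)$ with $$\|f\|_{n,N}=\sup_{x\in\mathbb R^d,\,|\alpha|\le n}\langle x\rangle^{-N}|\partial^\alpha f(x)|<\infty ,$$ let $X_n=\bigcup_{N}X_{n,N}$ carry the locally convex inductive limit topology (the finest locally convex vector space topology for which all inclusions $X_{n,N}\hookrightarrow X_n$ are continuous), and let $\mathcal O_M(\mathbb R^d)=\bigcap_n X_n$ carry the projective limit topology (the coarsest topology for which all inclusions $\mathcal O_M(\mathbb R^d)\hookrightarrow X_n$ are continuous). Then: 1. this topology is the natural (Schwartz) topology of $\mathcal O_M(\mathbb R^d)$, i.e. the locally convex topology given by the seminorms $f\mapsto\sup_{x}|\varphi(x)\,\partial^\alpha f(x)|$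 with $\varphi\in\mathcal S(\mathbb R^d)$ and $\alpha\in\mathbb N_0^d$; 2. with this topology $\mathcal O_M(\mathbb R^d)$ is bornological, i.e. it is a locally convex space in which every absolutely convex set that absorbs all bounded sets is a neighbourhood of $0$. -/

import Mathlib

open scoped Topology ContDiff SchwartzMap

noncomputable section

/-- A locally convex space `E` over `ℂ` is bornological if every absolutely convex subset `U` which
absorbs all (von Neumann) bounded sets is a neighbourhood of zero. -/
class IsBornologicalSpace (E : Type*) [AddCommGroup E] [Module ℂ E] [Module ℝ E]
    [IsScalarTower ℝ ℂ E] [TopologicalSpace E] : Prop where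
  isTopologicalAddGroup : IsTopologicalAddGroup E
  continuousSMul : ContinuousSMul ℂ E
  locallyConvexSpace : LocallyConvexSpace ℝ E
  mem_nhds_zero : ∀ U : Set E, Convex ℝ U → Balanced ℂ U →
    (∀ B : Set E, Bornology.IsVonNBounded ℂ B → Absorbs ℂ U B) → U ∈ 𝓝 (0 : E)

namespace SlowlyIncreasing

/-- The weight `⟨x⟩ = 1 + |x|²` on `ℝ^d`. -/
def bracket {d : ℕ} (x : EuclideanSpace ℝ (Fin d)) : ℝ := 1 + ‖x‖ ^ 2

lemma one_le_bracket {d : ℕ} (x : EuclideanSpace ℝ (Fin d)) : 1 ≤ bracket x := by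
  unfold bracket; nlinarith [sq_nonneg ‖x‖]

lemma bracket_pos {d : ℕ} (x : EuclideanSpace ℝ (Fin d)) : 0 < bracket x :=
  lt_of_lt_of_le one_pos (one_le_bracket x)

/-! ### The Banach spaces `X_{n,N}` -/

/-- The space `X_{n,N}` of all `f ∈ C^n(ℝ^d)` for which `⟨x⟩^{-N} |∂^α f(x)|` is bounded for all
`|α| ≤ n`. The norm of the `k`-th derivative is, up to constants depending on `d` and `k` only, the
maximum of the `|∂^α f(x)|` with `|α| = k`. -/
def stepSubmodule (d n N : ℕ) : Submodule ℂ (EuclideanSpace ℝ (Fin d) → ℂ) where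
  carrier := {f | ContDiff ℝ n f ∧
    ∃ C : ℝ, ∀ k ≤ n, ∀ x, ‖iteratedFDeriv ℝ k f x‖ ≤ C * bracket x ^ N}
  add_mem' := by
    rintro f g ⟨hf, C, hC⟩ ⟨hg, D, hD⟩
    refine ⟨hf.add hg, C + D, fun k hk x => ?_⟩
    have hk' : (k : WithTop ℕ∞) ≤ n := by exact_mod_cast hk
    rw [iteratedFDeriv_add_apply (hf.of_le hk').contDiffAt (hg.of_le hk').contDiffAt, add_mul]
    exact (norm_add_le _ _).trans (add_le_add (hC k hk x) (hD k hk x))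
  zero_mem' := ⟨contDiff_const, 0, fun k _ x => by simp⟩
  smul_mem' := by
    rintro c f ⟨hf, C, hC⟩
    refine ⟨hf.const_smul c, ‖c‖ * C, fun k hk x => ?_⟩
    have hk' : (k : WithTop ℕ∞) ≤ n := by exact_mod_cast hk
    rw [iteratedFDeriv_const_smul_apply (hf.of_le hk').contDiffAt, norm_smul, mul_assoc]
    exact mul_le_mul_of_nonneg_left (hC k hk x) (norm_nonneg c)

/-- `X_{n,N}` as a type of its own, so that it does not inherit the topology of pointwise
convergence. -/
def StepSpace (d n N : ℕ) : Type := ↥(stepSubmodule d n N)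

instance (d n N : ℕ) : AddCommGroup (StepSpace d n N) :=
  inferInstanceAs (AddCommGroup ↥(stepSubmodule d n N))

instance (d n N : ℕ) : Module ℂ (StepSpace d n N) :=
  inferInstanceAs (Module ℂ ↥(stepSubmodule d n N))

lemma bddAbove_stepNorm {d n N : ℕ} (f : StepSpace d n N) :
    BddAbove (Set.range fun p : Fin (n + 1) × EuclideanSpace ℝ (Fin d) =>
      (bracket p.2 ^ N)⁻¹ * ‖iteratedFDeriv ℝ p.1 f.1 p.2‖) := by
  obtain ⟨-, C, hC⟩ := f.2
  refine ⟨C, ?_⟩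
  rintro _ ⟨⟨k, x⟩, rfl⟩
  have hb := pow_pos (bracket_pos x) N
  have := hC k (Nat.lt_succ_iff.mp k.2) x
  simp only
  rw [inv_mul_le_iff₀ hb]
  linarith

/-- The norm `‖f‖_{n,N} = sup { ⟨x⟩^{-N} |D^k f(x)| : x ∈ ℝ^d, k ≤ n }` of `X_{n,N}`. -/
def stepNorm (d n N : ℕ) : Seminorm ℂ (StepSpace d n N) :=
  Seminorm.of
    (fun f => ⨆ p : Fin (n + 1) × EuclideanSpace ℝ (Fin d),
      (bracket p.2 ^ N)⁻¹ * ‖iteratedFDeriv ℝ p.1 f.1 p.2‖)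
    (by
      intro f g
      refine ciSup_le fun p => ?_
      have hk' : ((p.1 : ℕ) : WithTop ℕ∞) ≤ n := by exact_mod_cast Nat.lt_succ_iff.mp p.1.2
      have e : iteratedFDeriv ℝ p.1 (f + g).1 p.2
          = iteratedFDeriv ℝ p.1 f.1 p.2 + iteratedFDeriv ℝ p.1 g.1 p.2 :=
        iteratedFDeriv_add_apply (f.2.1.of_le hk').contDiffAt (g.2.1.of_le hk').contDiffAt
      have hb := inv_nonneg.mpr (pow_pos (bracket_pos p.2) N).le
      rw [e]
      refine (mul_le_mul_of_nonneg_left (norm_add_le _ _) hb).trans ?_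
      rw [mul_add]
      exact add_le_add (le_ciSup (bddAbove_stepNorm f) p) (le_ciSup (bddAbove_stepNorm g) p))
    (by
      intro c f
      rw [Real.mul_iSup_of_nonneg (norm_nonneg c)]
      refine iSup_congr fun p => ?_
      have hk' : ((p.1 : ℕ) : WithTop ℕ∞) ≤ n := by exact_mod_cast Nat.lt_succ_iff.mp p.1.2
      have e : iteratedFDeriv ℝ p.1 (c • f).1 p.2 = c • iteratedFDeriv ℝ p.1 f.1 p.2 :=
        iteratedFDeriv_const_smul_apply (f.2.1.of_le hk').contDiffAt
      rw [e, norm_smul]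
      ring)

instance (d n N : ℕ) : TopologicalSpace (StepSpace d n N) :=
  (stepNorm d n N).toSeminormedAddCommGroup.toUniformSpace.toTopologicalSpace

/-! ### The LB-spaces `X_n` -/

/-- `X_n = ⋃_N X_{n,N}`. -/
def lbSubmodule (d n : ℕ) : Submodule ℂ (EuclideanSpace ℝ (Fin d) → ℂ) where
  carrier := {f | ∃ N : ℕ, f ∈ stepSubmodule d n N}
  add_mem' := by
    have mono : ∀ {N M : ℕ}, N ≤ M → stepSubmodule d n N ≤ stepSubmodule d n M := by
      rintro N M h f ⟨hf, C, hC⟩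
      refine ⟨hf, |C|, fun k hk x => (hC k hk x).trans ?_⟩
      exact mul_le_mul (le_abs_self C) (pow_le_pow_right₀ (one_le_bracket x) h)
        (pow_pos (bracket_pos x) N).le (abs_nonneg C)
    rintro f g ⟨N, hf⟩ ⟨M, hg⟩
    exact ⟨max N M, add_mem (mono (le_max_left N M) hf) (mono (le_max_right N M) hg)⟩
  zero_mem' := ⟨0, zero_mem _⟩
  smul_mem' := by
    rintro c f ⟨N, hf⟩
    exact ⟨N, Submodule.smul_mem _ c hf⟩

/-- `X_n` as a type of its own. -/
def LBSpace (d n : ℕ) : Type := ↥(lbSubmodule d n)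

instance (d n : ℕ) : AddCommGroup (LBSpace d n) :=
  inferInstanceAs (AddCommGroup ↥(lbSubmodule d n))

instance (d n : ℕ) : Module ℂ (LBSpace d n) :=
  inferInstanceAs (Module ℂ ↥(lbSubmodule d n))

instance (d n : ℕ) : Module ℝ (LBSpace d n) :=
  inferInstanceAs (Module ℝ ↥(lbSubmodule d n))

/-- The inclusion `X_{n,N} → X_n`. -/
def stepInclusion (d n N : ℕ) : StepSpace d n N →ₗ[ℂ] LBSpace d n where
  toFun f := ⟨f.1, N, f.2⟩
  map_add' _ _ := rfl
  map_smul' _ _ := rfl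

/-- The inductive limit topology of the LB-space `X_n`: the finest locally convex vector space
topology which makes all the inclusions `X_{n,N} → X_n` continuous. -/
instance (d n : ℕ) : TopologicalSpace (LBSpace d n) :=
  sInf {t : TopologicalSpace (LBSpace d n) |
    @IsTopologicalAddGroup (LBSpace d n) t _ ∧
    @ContinuousSMul ℂ (LBSpace d n) _ _ t ∧
    @LocallyConvexSpace ℝ (LBSpace d n) _ _ _ _ t ∧
    ∀ N : ℕ, Continuous[inferInstance, t] (stepInclusion d n N)}

/-! ### The space `𝓞_M` -/

/-- The space `𝓞_M(ℝ^d)` of slowly increasing functions: smooth functions all of whose derivatives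
are polynomially bounded. -/
def omSubmodule (d : ℕ) : Submodule ℂ (EuclideanSpace ℝ (Fin d) → ℂ) where
  carrier := {f | f.HasTemperateGrowth}
  add_mem' hf hg := hf.add hg
  zero_mem' := Function.HasTemperateGrowth.zero
  smul_mem' c _ hf := (Function.HasTemperateGrowth.const c).smul hf

/-- `𝓞_M(ℝ^d)` as a type of its own. -/
def OM (d : ℕ) : Type := ↥(omSubmodule d)

instance (d : ℕ) : AddCommGroup (OM d) := inferInstanceAs (AddCommGroup ↥(omSubmodule d))

instance (d : ℕ) : Module ℂ (OM d) := inferInstanceAs (Module ℂ ↥(omSubmodule d))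

instance (d : ℕ) : Module ℝ (OM d) := inferInstanceAs (Module ℝ ↥(omSubmodule d))

instance (d : ℕ) : IsScalarTower ℝ ℂ (OM d) :=
  inferInstanceAs (IsScalarTower ℝ ℂ ↥(omSubmodule d))

lemma mem_lbSubmodule_of_mem_omSubmodule {d : ℕ} (n : ℕ) {f : EuclideanSpace ℝ (Fin d) → ℂ}
    (hf : f ∈ omSubmodule d) : f ∈ lbSubmodule d n := by
  obtain ⟨N, C, hC0, hC⟩ := Function.HasTemperateGrowth.norm_iteratedFDeriv_le_uniform hf n
  refine ⟨N, hf.1.of_le (by exact_mod_cast le_top), C * 2 ^ N, fun k hk x => ?_⟩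
  refine (hC k hk x).trans ?_
  rw [mul_assoc, ← mul_pow]
  have h : 1 + ‖x‖ ≤ 2 * bracket x := by
    unfold bracket; nlinarith [sq_nonneg (‖x‖ - 1)]
  exact mul_le_mul_of_nonneg_left (pow_le_pow_left₀ (by positivity) h N) hC0

/-- `𝓞_M` is the intersection of the spaces `X_n`. -/
lemma mem_omSubmodule_iff {d : ℕ} {f : EuclideanSpace ℝ (Fin d) → ℂ} :
    f ∈ omSubmodule d ↔ ∀ n, f ∈ lbSubmodule d n := by
  refine ⟨fun hf n => mem_lbSubmodule_of_mem_omSubmodule n hf, fun h => ⟨?_, fun n => ?_⟩⟩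
  · refine contDiff_infty.mpr fun n => ?_
    obtain ⟨N, hN⟩ := h n
    exact hN.1
  · obtain ⟨N, -, C, hC⟩ := h n
    refine ⟨2 * N, |C|, fun x => (hC n le_rfl x).trans ?_⟩
    have hb : bracket x ≤ (1 + ‖x‖) ^ 2 := by
      unfold bracket; nlinarith [norm_nonneg x]
    rw [pow_mul]
    exact mul_le_mul (le_abs_self C) (pow_le_pow_left₀ (bracket_pos x).le hb N)
      (pow_pos (bracket_pos x) N).le (abs_nonneg C)

/-- The inclusion `𝓞_M → X_n`. -/
def omInclusion (d n : ℕ) : OM d →ₗ[ℂ] LBSpace d n where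
  toFun f := ⟨f.1, mem_lbSubmodule_of_mem_omSubmodule n f.2⟩
  map_add' _ _ := rfl
  map_smul' _ _ := rfl

/-- The topology of `𝓞_M` as the projective limit of the LB-spaces `X_n`: the coarsest topology
which makes all the inclusions `𝓞_M → X_n` continuous. -/
instance (d : ℕ) : TopologicalSpace (OM d) :=
  ⨅ n : ℕ, TopologicalSpace.induced (omInclusion d n) inferInstance

lemma bddAbove_schwartzSeminorm {d : ℕ} (φ : 𝓢(EuclideanSpace ℝ (Fin d), ℂ)) (k : ℕ) (f : OM d) :
    BddAbove (Set.range fun x : EuclideanSpace ℝ (Fin d) =>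
      ‖φ x‖ * ‖iteratedFDeriv ℝ k f.1 x‖) := by
  obtain ⟨N, C, hC⟩ := f.2.2 k
  have h := fun x => φ.one_add_le_sup_seminorm_apply (𝕜 := ℂ) (m := (N, 0)) (k := N) (n := 0)
    le_rfl le_rfl x
  set S := 2 ^ (N, 0).1 * (Finset.Iic (N, 0)).sup
    (fun m => SchwartzMap.seminorm ℂ (E := EuclideanSpace ℝ (Fin d)) (F := ℂ) m.1 m.2) φ
  refine ⟨|C| * S, ?_⟩
  rintro _ ⟨x, rfl⟩
  have hx := h x
  rw [norm_iteratedFDeriv_zero] at hx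
  calc ‖φ x‖ * ‖iteratedFDeriv ℝ k f.1 x‖
      ≤ ‖φ x‖ * (|C| * (1 + ‖x‖) ^ N) := by
        refine mul_le_mul_of_nonneg_left ((hC x).trans ?_) (norm_nonneg _)
        exact mul_le_mul_of_nonneg_right (le_abs_self C) (by positivity)
    _ = |C| * ((1 + ‖x‖) ^ N * ‖φ x‖) := by ring
    _ ≤ |C| * S := mul_le_mul_of_nonneg_left hx (abs_nonneg C)

/-- Schwartz's seminorms `f ↦ sup_x |φ(x) D^k f(x)|` on `𝓞_M`, where `φ` is a rapidly decreasing
test function and `k` is an order of differentiation. -/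
def schwartzSeminorms (d : ℕ) :
    SeminormFamily ℂ (OM d) (𝓢(EuclideanSpace ℝ (Fin d), ℂ) × ℕ) := fun i =>
  Seminorm.of
    (fun f => ⨆ x : EuclideanSpace ℝ (Fin d), ‖i.1 x‖ * ‖iteratedFDeriv ℝ i.2 f.1 x‖)
    (by
      intro f g
      refine ciSup_le fun x => ?_
      have hk' : (i.2 : WithTop ℕ∞) ≤ ∞ := by exact_mod_cast le_top
      have e : iteratedFDeriv ℝ i.2 (f + g).1 x
          = iteratedFDeriv ℝ i.2 f.1 x + iteratedFDeriv ℝ i.2 g.1 x :=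
        iteratedFDeriv_add_apply (f.2.1.of_le hk').contDiffAt (g.2.1.of_le hk').contDiffAt
      rw [e]
      refine (mul_le_mul_of_nonneg_left (norm_add_le _ _) (norm_nonneg _)).trans ?_
      rw [mul_add]
      exact add_le_add (le_ciSup (bddAbove_schwartzSeminorm i.1 i.2 f) x)
        (le_ciSup (bddAbove_schwartzSeminorm i.1 i.2 g) x))
    (by
      intro c f
      rw [Real.mul_iSup_of_nonneg (norm_nonneg c)]
      refine iSup_congr fun x => ?_
      have hk' : (i.2 : WithTop ℕ∞) ≤ ∞ := by exact_mod_cast le_top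
      have e : iteratedFDeriv ℝ i.2 (c • f).1 x = c • iteratedFDeriv ℝ i.2 f.1 x :=
        iteratedFDeriv_const_smul_apply (f.2.1.of_le hk').contDiffAt
      rw [e, norm_smul]
      ring)

end SlowlyIncreasing

end

/-!
The projective limit topology of `𝓞_M` is given by Schwartz's seminorms and is bornological. Write
`⟨x⟩ = 1 + |x|²`. Both claims follow by elementary estimates from a partition of unity into the
shells `j - 1 < |x|² < j + 1` (`shell`), whose derivatives grow polynomially, uniformly in `j`.

*From balls to Schwartz seminorms* (`exists_schwartzMap_of_absorbs`). Let `V ⊆ 𝓞_M` be convex and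
suppose that for a fixed `n` it contains the functions in `𝓞_M` whose norm in `X_{n,N}` is at most
`ε_N > 0`, for every `N`. Decompose `f` into its pieces in the first `J` shells and the part outside
a ball. The outer part is small in some `X_{n,N}` if `J` is large, so twice it lies in `V`. The
piece in the `j`-th shell lies in `V`, with a factor to spare that makes the pieces summable, as
soon as the derivatives of `f` of order at most `n` are bounded by some `a_j` there; using the balls
with `N ≤ j` one may take `a_j` growing faster than every power of `j`. Hence `1 / a_j` is dominated
by a Schwartz function `φ`, and `V` contains all `f` with `|φ| |D^k f| ≤ 1` for `k ≤ n`.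
Applied to a convex neighbourhood of zero in `X_n` this shows that Schwartz's seminorms define the
topology; the converse, that they are continuous, holds because they extend to `X_n` and are bounded
on the unit balls of the `X_{n,N}` (`continuous_lbSeminorm`).

*Bornologicity.* It remains to find, for a convex set `U` absorbing all bounded sets, an `n` such
that `U` absorbs the traces on `𝓞_M` of the unit balls of all `X_{n,N}`
(`exists_absorbs_of_absorbs_bounded`). The crucial fact is `exists_smooth_approx`: every function in
the unit ball of `X_{n+1,N}` is the sum of a function from a bounded subset of `𝓞_M` depending on
`n` and `N` only, and a function whose norm in `X_{n,1}` is at most `5`, however large `N` is. It is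
obtained by mollifying the piece in the `j`-th shell at a scale which is a negative power of `j`:
this costs one derivative, and it keeps the growth of all derivatives polynomial. If no `n` were as
desired, the remainders of functions that are not absorbed would form a sequence which is bounded in
`𝓞_M`, since all but finitely many of its terms are in `5` times the unit ball of `X_{k,1}` for
each `k`, but which is not absorbed by `U`.
-/

namespace SlowlyIncreasing

open MeasureTheory

variable {d : ℕ}

/-! ### Smooth radial cutoffs -/

/-- All derivatives of the smooth transition function are bounded: they are continuous and vanish,
up to the constant of order zero, outside `[0, 1]`. -/
lemma exists_norm_iteratedFDeriv_smoothTransition_le (n : ℕ) :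
    ∃ C : ℝ, 1 ≤ C ∧ ∀ k ≤ n, ∀ t, ‖iteratedFDeriv ℝ k Real.smoothTransition t‖ ≤ C := by
  have hk : ∀ k : ℕ, ∃ C : ℝ, ∀ t, ‖iteratedFDeriv ℝ k Real.smoothTransition t‖ ≤ C := by
    intro k
    have hcont : Continuous fun t => ‖iteratedFDeriv ℝ k Real.smoothTransition t‖ :=
      ((Real.smoothTransition.contDiff (n := ⊤)).continuous_iteratedFDeriv
        (by exact_mod_cast le_top)).norm
    obtain ⟨C, hC⟩ := (isCompact_Icc (a := (-1 : ℝ)) (b := 2)).bddAbove_image hcont.continuousOn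
    have hconst : ∀ c : ℝ, ‖c‖ ≤ 1 → ∀ t : ℝ, ‖iteratedFDeriv ℝ k (fun _ : ℝ => c) t‖ ≤ 1 := by
      intro c hc t
      cases k with
      | zero => simpa using hc
      | succ k => simp [iteratedFDeriv_const_of_ne (𝕜 := ℝ) k.succ_ne_zero]
    refine ⟨max C 1, fun t => ?_⟩
    by_cases h1 : t < -1
    · have : Real.smoothTransition =ᶠ[𝓝 t] fun _ => 0 := by
        filter_upwards [Iio_mem_nhds h1] with y hy
        exact Real.smoothTransition.zero_of_nonpos (by linarith [Set.mem_Iio.mp hy])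
      rw [(this.iteratedFDeriv ℝ k).self_of_nhds]
      exact (hconst 0 (by simp) t).trans (le_max_right _ _)
    by_cases h2 : 2 < t
    · have : Real.smoothTransition =ᶠ[𝓝 t] fun _ => 1 := by
        filter_upwards [Ioi_mem_nhds h2] with y hy
        exact Real.smoothTransition.one_of_one_le (by linarith [Set.mem_Ioi.mp hy])
      rw [(this.iteratedFDeriv ℝ k).self_of_nhds]
      exact (hconst 1 (by simp) t).trans (le_max_right _ _)
    exact (hC (Set.mem_image_of_mem _ ⟨not_lt.mp h1, not_lt.mp h2⟩)).trans (le_max_left _ _)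
  choose C hC using hk
  refine ⟨1 + ∑ k ∈ Finset.range (n + 1), |C k|, ?_, fun k hkn t => ?_⟩
  · linarith [Finset.sum_nonneg fun k (_ : k ∈ Finset.range (n + 1)) => abs_nonneg (C k)]
  · have := Finset.single_le_sum (f := fun k => |C k|) (fun k _ => abs_nonneg _)
      (Finset.mem_range.mpr (Nat.lt_succ_of_le hkn))
    linarith [hC k t, le_abs_self (C k)]

lemma continuous_bracket : Continuous (bracket (d := d)) := by
  unfold bracket; fun_prop

lemma bracket_le_one_add_norm_sq (x : EuclideanSpace ℝ (Fin d)) : bracket x ≤ (1 + ‖x‖) ^ 2 := by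
  unfold bracket; nlinarith [norm_nonneg x]

lemma one_add_norm_le_two_mul_bracket (x : EuclideanSpace ℝ (Fin d)) :
    1 + ‖x‖ ≤ 2 * bracket x := by
  unfold bracket; nlinarith [sq_nonneg (‖x‖ - 1)]

/-- The cutoff away from a ball: it vanishes where `|x|² ≤ c` and equals `1` where
`|x|² ≥ c + 1`. -/
noncomputable def outerCutoff (d : ℕ) (c : ℝ) (x : EuclideanSpace ℝ (Fin d)) : ℝ :=
  Real.smoothTransition (bracket x - 1 - c)

lemma contDiff_outerCutoff (c : ℝ) : ContDiff ℝ ∞ (outerCutoff d c) := by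
  refine Real.smoothTransition.contDiff.comp ?_
  unfold bracket
  exact ((contDiff_const.add (contDiff_id.norm_sq ℝ)).sub contDiff_const).sub contDiff_const

lemma outerCutoff_eq_zero {c : ℝ} {x : EuclideanSpace ℝ (Fin d)} (h : bracket x ≤ c + 1) :
    outerCutoff d c x = 0 :=
  Real.smoothTransition.zero_of_nonpos (by linarith)

lemma outerCutoff_eq_one {c : ℝ} {x : EuclideanSpace ℝ (Fin d)} (h : c + 2 ≤ bracket x) :
    outerCutoff d c x = 1 :=
  Real.smoothTransition.one_of_one_le (by linarith)

/-- The derivatives of the cutoffs grow at most polynomially, uniformly in the radius. -/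
lemma exists_norm_iteratedFDeriv_outerCutoff_le (d n : ℕ) :
    ∃ (C : ℝ) (K : ℕ), 1 ≤ C ∧ ∀ c, ∀ k ≤ n, ∀ x,
      ‖iteratedFDeriv ℝ k (outerCutoff d c) x‖ ≤ C * bracket x ^ K := by
  obtain ⟨A, hA1, hA⟩ := exists_norm_iteratedFDeriv_smoothTransition_le n
  obtain ⟨m, B, hB0, hB⟩ := Function.HasTemperateGrowth.norm_iteratedFDeriv_le_uniform
    (Function.hasTemperateGrowth_norm_sq (EuclideanSpace ℝ (Fin d))) n
  set D : ℝ := (B + 1) * 2 ^ m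
  have hD1 : 1 ≤ D := by
    have : (1 : ℝ) ≤ 2 ^ m := one_le_pow₀ (by norm_num)
    nlinarith
  refine ⟨n.factorial * A * D ^ n, m * n, ?_, fun c k hk x => ?_⟩
  · have h1 : (1 : ℝ) ≤ n.factorial := by exact_mod_cast n.factorial_pos
    exact one_le_mul_of_one_le_of_one_le (one_le_mul_of_one_le_of_one_le h1 hA1)
      (one_le_pow₀ hD1)
  have hbm : (1 : ℝ) ≤ bracket x ^ m := one_le_pow₀ (one_le_bracket x)
  have hDb : 1 ≤ D * bracket x ^ m := one_le_mul_of_one_le_of_one_le hD1 hbm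
  have hfun : outerCutoff d c = Real.smoothTransition ∘ fun x => ‖x‖ ^ 2 + -c := by
    funext y; simp only [outerCutoff, bracket, Function.comp]; congr 1; ring
  have hsq : ContDiff ℝ ∞ fun x : EuclideanSpace ℝ (Fin d) => ‖x‖ ^ 2 := contDiff_id.norm_sq ℝ
  rw [hfun]
  have := norm_iteratedFDeriv_comp_le (𝕜 := ℝ) (n := k) (N := ∞)
    (g := Real.smoothTransition) (f := fun x : EuclideanSpace ℝ (Fin d) => ‖x‖ ^ 2 + -c)
    Real.smoothTransition.contDiff (hsq.add contDiff_const) (by exact_mod_cast le_top) x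
    (C := A) (D := D * bracket x ^ m) (fun i hi => hA i (hi.trans hk) _)
    (by
      intro i hi1 hik
      have e : iteratedFDeriv ℝ i (fun x : EuclideanSpace ℝ (Fin d) => ‖x‖ ^ 2 + -c) x
          = iteratedFDeriv ℝ i (fun x : EuclideanSpace ℝ (Fin d) => ‖x‖ ^ 2) x := by
        have hi : (i : WithTop ℕ∞) ≤ ∞ := by exact_mod_cast le_top
        have := iteratedFDeriv_add_apply (x := x) (hsq.of_le hi).contDiffAt
          (contDiff_const (𝕜 := ℝ) (n := i) (c := -c)).contDiffAt
        rw [iteratedFDeriv_const_of_ne (by omega)] at this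
        simpa [Pi.add_def] using this
      rw [e]
      refine (hB i (hik.trans hk) x).trans ?_
      refine le_trans ?_ (le_self_pow₀ hDb (by omega))
      calc B * (1 + ‖x‖) ^ m ≤ (B + 1) * (2 * bracket x) ^ m := by
            gcongr
            · linarith
            · exact one_add_norm_le_two_mul_bracket x
        _ = D * bracket x ^ m := by rw [mul_pow]; ring)
  refine this.trans ?_
  have h1 : (k.factorial : ℝ) ≤ n.factorial := by exact_mod_cast Nat.factorial_le hk
  calc (k.factorial : ℝ) * A * (D * bracket x ^ m) ^ k
      ≤ n.factorial * A * (D * bracket x ^ m) ^ n := by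
        gcongr
    _ = n.factorial * A * D ^ n * bracket x ^ (m * n) := by rw [mul_pow, pow_mul]; ring

/-- The `j`-th function of a smooth partition of unity subordinate to the cover of `ℝ^d` by the
spherical shells `j - 1 < |x|² < j + 1`. -/
noncomputable def shell (d j : ℕ) (x : EuclideanSpace ℝ (Fin d)) : ℝ :=
  outerCutoff d ((j : ℝ) - 1) x - outerCutoff d j x

lemma contDiff_shell (j : ℕ) : ContDiff ℝ ∞ (shell d j) :=
  (contDiff_outerCutoff _).sub (contDiff_outerCutoff _)

lemma shell_eq_zero_of_le {j : ℕ} {x : EuclideanSpace ℝ (Fin d)} (h : bracket x ≤ j) :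
    shell d j x = 0 := by
  rw [shell, outerCutoff_eq_zero (by linarith), outerCutoff_eq_zero (by linarith), sub_zero]

lemma shell_eq_zero_of_ge {j : ℕ} {x : EuclideanSpace ℝ (Fin d)} (h : (j : ℝ) + 2 ≤ bracket x) :
    shell d j x = 0 := by
  rw [shell, outerCutoff_eq_one (by linarith), outerCutoff_eq_one (by linarith), sub_self]

lemma shell_nonneg (j : ℕ) (x : EuclideanSpace ℝ (Fin d)) : 0 ≤ shell d j x :=
  sub_nonneg.mpr (Real.smoothTransition.monotone (by linarith))

lemma sum_shell_add_outerCutoff (J : ℕ) (x : EuclideanSpace ℝ (Fin d)) :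
    ∑ j ∈ Finset.range J, shell d j x + outerCutoff d ((J : ℝ) - 1) x = 1 := by
  induction J with
  | zero =>
    rw [Finset.sum_range_zero, zero_add]
    exact outerCutoff_eq_one (by linarith [one_le_bracket x, Nat.cast_zero (R := ℝ)])
  | succ J ih =>
    rw [Finset.sum_range_succ, Nat.cast_succ, add_sub_cancel_right, shell]
    linarith

lemma exists_norm_iteratedFDeriv_shell_le (d n : ℕ) :
    ∃ (C : ℝ) (K : ℕ), 1 ≤ C ∧ ∀ j, ∀ k ≤ n, ∀ x,
      ‖iteratedFDeriv ℝ k (shell d j) x‖ ≤ C * bracket x ^ K := by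
  obtain ⟨C, K, hC1, hC⟩ := exists_norm_iteratedFDeriv_outerCutoff_le d n
  refine ⟨2 * C, K, by linarith, fun j k hk x => ?_⟩
  have hk' : (k : WithTop ℕ∞) ≤ ∞ := by exact_mod_cast le_top
  have e : iteratedFDeriv ℝ k (shell d j) x = _ := iteratedFDeriv_sub_apply (x := x)
    ((contDiff_outerCutoff (d := d) ((j : ℝ) - 1)).of_le hk').contDiffAt
    ((contDiff_outerCutoff (d := d) j).of_le hk').contDiffAt
  rw [e]
  refine (norm_sub_le _ _).trans ?_
  linarith [hC ((j : ℝ) - 1) k hk x, hC j k hk x]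

/-- If `h` vanishes where `⟨x⟩` lies in a given open set, then so do its derivatives. -/
lemma iteratedFDeriv_eq_zero_of_bracket {F : Type*} [NormedAddCommGroup F] [NormedSpace ℝ F]
    {h : EuclideanSpace ℝ (Fin d) → F} {s : Set ℝ} (hs : IsOpen s)
    (hh : ∀ x, bracket x ∈ s → h x = 0) (k : ℕ) {x : EuclideanSpace ℝ (Fin d)}
    (hx : bracket x ∈ s) : iteratedFDeriv ℝ k h x = 0 := by
  have : h =ᶠ[𝓝 x] fun _ => 0 := by
    filter_upwards [continuous_bracket.continuousAt.preimage_mem_nhds (hs.mem_nhds hx)] with y hy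
    exact hh y hy
  rw [(this.iteratedFDeriv ℝ k).self_of_nhds]
  simp

/-- A Leibniz estimate for products in terms of uniform bounds on the derivatives. -/
lemma norm_iteratedFDeriv_smul_le_of_le {n : ℕ} {u : EuclideanSpace ℝ (Fin d) → ℝ}
    {f : EuclideanSpace ℝ (Fin d) → ℂ} (hu : ContDiff ℝ n u) (hf : ContDiff ℝ n f)
    {x : EuclideanSpace ℝ (Fin d)} {A B : ℝ} (hA : ∀ k ≤ n, ‖iteratedFDeriv ℝ k u x‖ ≤ A)
    (hB : ∀ k ≤ n, ‖iteratedFDeriv ℝ k f x‖ ≤ B) :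
    ∀ k ≤ n, ‖iteratedFDeriv ℝ k (fun y => u y • f y) x‖ ≤ 2 ^ n * A * B := by
  intro k hk
  have hA0 : 0 ≤ A := (norm_nonneg _).trans (hA 0 (Nat.zero_le n))
  have hB0 : 0 ≤ B := (norm_nonneg _).trans (hB 0 (Nat.zero_le n))
  refine (norm_iteratedFDeriv_smul_le hu hf x (by exact_mod_cast hk)).trans ?_
  calc ∑ i ∈ Finset.range (k + 1), (k.choose i : ℝ) * ‖iteratedFDeriv ℝ i u x‖
        * ‖iteratedFDeriv ℝ (k - i) f x‖
      ≤ ∑ i ∈ Finset.range (k + 1), (k.choose i : ℝ) * A * B := by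
        refine Finset.sum_le_sum fun i hi => ?_
        have := Finset.mem_range_succ_iff.mp hi
        gcongr
        · exact hA i (this.trans hk)
        · exact hB _ ((Nat.sub_le k i).trans hk)
    _ = 2 ^ k * A * B := by
        rw [← Finset.sum_mul, ← Finset.sum_mul]
        norm_cast
        rw [Nat.sum_range_choose]
    _ ≤ 2 ^ n * A * B := by gcongr; norm_num

/-! ### Locally finite sums -/

/-- The sum of a sequence of functions of which only those with index `j < 3⟨x⟩` may be nonzero
at the point `x`. -/
noncomputable def locSum {F : Type*} [AddCommMonoid F] (f : ℕ → EuclideanSpace ℝ (Fin d) → F)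
    (x : EuclideanSpace ℝ (Fin d)) : F :=
  ∑ j ∈ Finset.range ⌈3 * bracket x⌉₊, f j x

lemma locSum_eq_sum_range {F : Type*} [AddCommMonoid F]
    {f : ℕ → EuclideanSpace ℝ (Fin d) → F}
    (hf : ∀ (j : ℕ) x, 3 * bracket x ≤ j → f j x = 0) {J : ℕ}
    {x : EuclideanSpace ℝ (Fin d)} (hJ : 3 * bracket x ≤ J) :
    locSum f x = ∑ j ∈ Finset.range J, f j x := by
  refine Finset.sum_subset (Finset.range_mono (Nat.ceil_le.mpr hJ)) fun j _ hj => hf j x ?_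
  exact Nat.ceil_le.mp (not_lt.mp fun h => hj (Finset.mem_range.mpr h))

lemma locSum_eventuallyEq {F : Type*} [AddCommMonoid F]
    {f : ℕ → EuclideanSpace ℝ (Fin d) → F}
    (hf : ∀ (j : ℕ) x, 3 * bracket x ≤ j → f j x = 0) {J : ℕ}
    {x : EuclideanSpace ℝ (Fin d)} (hJ : 3 * bracket x < J) :
    locSum f =ᶠ[𝓝 x] fun y => ∑ j ∈ Finset.range J, f j y := by
  have : ContinuousAt (fun y : EuclideanSpace ℝ (Fin d) => 3 * bracket y) x :=
    (continuous_const.mul continuous_bracket).continuousAt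
  filter_upwards [this.preimage_mem_nhds (Iio_mem_nhds hJ)] with y hy
  exact locSum_eq_sum_range hf (le_of_lt hy)

section locSum

variable {F : Type*} [NormedAddCommGroup F] [NormedSpace ℝ F]
  {f : ℕ → EuclideanSpace ℝ (Fin d) → F}

lemma contDiff_locSum (hf : ∀ (j : ℕ) x, 3 * bracket x ≤ j → f j x = 0)
    (hc : ∀ j, ContDiff ℝ ∞ (f j)) : ContDiff ℝ ∞ (locSum f) := by
  refine contDiff_iff_contDiffAt.mpr fun x => ?_
  obtain ⟨J, hJ⟩ := exists_nat_gt (3 * bracket x)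
  exact (ContDiff.sum fun j _ => hc j).contDiffAt.congr_of_eventuallyEq (locSum_eventuallyEq hf hJ)

/-- At most `5⟨x⟩` of the terms of a locally finite sum contribute near `x`. -/
lemma norm_iteratedFDeriv_locSum_le (hf : ∀ (j : ℕ) x, 3 * bracket x ≤ j → f j x = 0)
    (hc : ∀ j, ContDiff ℝ ∞ (f j)) (k : ℕ) {x : EuclideanSpace ℝ (Fin d)} {B : ℝ}
    (hB0 : 0 ≤ B)
    (hB : ∀ j : ℕ, (j : ℝ) ≤ 5 * bracket x → ‖iteratedFDeriv ℝ k (f j) x‖ ≤ B) :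
    ‖iteratedFDeriv ℝ k (locSum f) x‖ ≤ 5 * bracket x * B := by
  have hb := one_le_bracket x
  set J := ⌈3 * bracket x⌉₊ + 1
  have hJ : 3 * bracket x < J := by
    push_cast [J]; linarith [Nat.le_ceil (3 * bracket x)]
  have hJ' : (J : ℝ) ≤ 5 * bracket x := by
    push_cast [J]; linarith [Nat.ceil_lt_add_one (show 0 ≤ 3 * bracket x by linarith)]
  rw [((locSum_eventuallyEq hf hJ).iteratedFDeriv ℝ k).self_of_nhds,
    iteratedFDeriv_sum fun j _ => (hc j).of_le (by exact_mod_cast le_top), Finset.sum_apply]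
  calc ‖∑ j ∈ Finset.range J, iteratedFDeriv ℝ k (f j) x‖
      ≤ ∑ j ∈ Finset.range J, ‖iteratedFDeriv ℝ k (f j) x‖ := norm_sum_le _ _
    _ ≤ ∑ j ∈ Finset.range J, B := by
        refine Finset.sum_le_sum fun j hj => hB j (le_trans ?_ hJ')
        exact_mod_cast (Finset.mem_range.mp hj).le
    _ = J * B := by simp
    _ ≤ 5 * bracket x * B := by gcongr

lemma locSum_shell_smul (f : EuclideanSpace ℝ (Fin d) → F) :
    locSum (fun j x => shell d j x • f x) = f := by
  funext x
  have hb := one_le_bracket x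
  have h := sum_shell_add_outerCutoff ⌈3 * bracket x⌉₊ x
  rw [outerCutoff_eq_zero (by linarith [Nat.le_ceil (3 * bracket x)]), add_zero] at h
  rw [locSum, ← Finset.sum_smul, h, one_smul]

end locSum

/-! ### Mollification -/

section Mollification

variable {E : Type} [NormedAddCommGroup E] [NormedSpace ℝ E] [FiniteDimensional ℝ E]
  [MeasurableSpace E] [BorelSpace E]

/-- The derivatives of a convolution are bounded by the sup norm of one factor and the derivatives
of the other. The bilinear map is arbitrary so that the induction on the order of
differentiation applies to the derivative of the second factor. -/
lemma norm_iteratedFDeriv_convolution_le {μ : Measure E} [μ.IsAddHaarMeasure]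
    {F : Type} [NormedAddCommGroup F]
    [NormedSpace ℝ F] {f : E → F} (hf : LocallyIntegrable f μ) {S : ℝ}
    (hS : ∀ x, ‖f x‖ ≤ S) (k : ℕ) :
    ∀ {G H : Type} [NormedAddCommGroup G] [NormedSpace ℝ G] [NormedAddCommGroup H]
      [NormedSpace ℝ H] (L : F →L[ℝ] G →L[ℝ] H) (_ : ‖L‖ ≤ 1) {ψ : E → G} (_ : ContDiff ℝ ∞ ψ)
      (_ : tsupport ψ ⊆ Metric.closedBall 0 1) {T : ℝ} (_ : ∀ x, ‖iteratedFDeriv ℝ k ψ x‖ ≤ T)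
      (x : E), ‖iteratedFDeriv ℝ k (convolution f ψ L μ) x‖
        ≤ S * T * μ.real (Metric.closedBall 0 1) := by
  have hS0 : 0 ≤ S := (norm_nonneg _).trans (hS 0)
  induction k with
  | zero =>
    intro G H _ _ _ _ L hL ψ hψ hsupp T hT x
    have hT' : ∀ y, ‖ψ y‖ ≤ T := fun y => by simpa using hT y
    rw [norm_iteratedFDeriv_zero, convolution_eq_swap]
    have h0 : ∀ y ∉ Metric.closedBall (0 : E) 1, L (f (x - y)) (ψ y) = 0 := fun y hy => by
      rw [image_eq_zero_of_notMem_tsupport fun h => hy (hsupp h), map_zero]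
    rw [← setIntegral_eq_integral_of_forall_compl_eq_zero h0]
    refine norm_setIntegral_le_of_norm_le_const (isCompact_closedBall _ _).measure_lt_top
      fun y _ => ?_
    calc ‖L (f (x - y)) (ψ y)‖ ≤ ‖L‖ * ‖f (x - y)‖ * ‖ψ y‖ := L.le_opNorm₂ _ _
      _ ≤ 1 * S * T := by
        gcongr
        · exact hS _
        · exact hT' y
      _ = S * T := by ring
  | succ k ih =>
    intro G H _ _ _ _ L hL ψ hψ hsupp T hT x
    have hcs : HasCompactSupport ψ :=
      HasCompactSupport.of_support_subset_isCompact (isCompact_closedBall (0 : E) 1)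
        ((subset_tsupport ψ).trans hsupp)
    have hfd : fderiv ℝ (convolution f ψ L μ) = convolution f (fderiv ℝ ψ) (L.precompR E) μ :=
      funext fun y => (hcs.hasFDerivAt_convolution_right L hf
        (hψ.of_le (by exact_mod_cast le_top)) y).fderiv
    rw [← norm_iteratedFDeriv_fderiv, hfd]
    refine ih (L.precompR E) ((L.norm_precompR_le E).trans hL)
      (hψ.fderiv_right (by simp)) ((tsupport_fderiv_subset ℝ).trans hsupp) (fun y => ?_) x
    rw [norm_iteratedFDeriv_fderiv]
    exact hT y

/-- A mollification at scale `ε` approximates a function with all derivatives of order `k` up to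
`ε` times a bound on the derivatives of order `k + 1`. -/
lemma norm_iteratedFDeriv_sub_convolution_le {μ : Measure E} [μ.IsAddHaarMeasure]
    {ρ : E → ℝ} {ε : ℝ} (hε : 0 < ε)
    (hsupp : Function.support ρ ⊆ Metric.ball 0 ε) (hρ0 : ∀ x, 0 ≤ ρ x)
    (hint : ∫ x, ρ x ∂μ = 1) (hρ : Continuous ρ) (k : ℕ) :
    ∀ {F : Type} [NormedAddCommGroup F] [NormedSpace ℝ F] [CompleteSpace F] {f : E → F}
      (_ : ContDiff ℝ ∞ f) (_ : HasCompactSupport f) {S : ℝ}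
      (_ : ∀ x, ‖iteratedFDeriv ℝ (k + 1) f x‖ ≤ S) (x : E),
      ‖iteratedFDeriv ℝ k (f - convolution ρ f (ContinuousLinearMap.lsmul ℝ ℝ) μ) x‖ ≤ ε * S := by
  induction k with
  | zero =>
    intro F _ _ _ f hf hc S hS x
    have hS' : ∀ y, ‖fderiv ℝ f y‖ ≤ S := fun y => by
      have := hS y
      rwa [zero_add, norm_iteratedFDeriv_one] at this
    have hS0 : 0 ≤ S := (norm_nonneg _).trans (hS x)
    rw [norm_iteratedFDeriv_zero, Pi.sub_apply, ← dist_eq_norm, dist_comm]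
    refine dist_convolution_le (by positivity) hsupp hρ0 hint
      hf.continuous.aestronglyMeasurable fun y hy => ?_
    rw [dist_eq_norm]
    calc ‖f y - f x‖ ≤ S * ‖y - x‖ :=
          convex_univ.norm_image_sub_le_of_norm_fderiv_le (𝕜 := ℝ)
            (fun z _ => hf.differentiable (by simp) z) (fun z _ => hS' z)
            (Set.mem_univ x) (Set.mem_univ y)
      _ ≤ S * ε := by
          gcongr
          rw [← dist_eq_norm]
          exact (Metric.mem_ball.mp hy).le
      _ = ε * S := mul_comm _ _
  | succ k ih =>
    intro F _ _ _ f hf hc S hS x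
    have hli : LocallyIntegrable ρ μ := hρ.locallyIntegrable
    have hfd : fderiv ℝ (f - convolution ρ f (ContinuousLinearMap.lsmul ℝ ℝ) μ)
        = fderiv ℝ f - convolution ρ (fderiv ℝ f) (ContinuousLinearMap.lsmul ℝ ℝ) μ := by
      funext y
      have h1 := (hf.differentiable (by simp) y).hasFDerivAt.sub
        (hc.hasFDerivAt_convolution_right (ContinuousLinearMap.lsmul ℝ ℝ) hli
          (hf.of_le (by exact_mod_cast le_top)) y)
      rw [h1.fderiv]
      rfl
    rw [← norm_iteratedFDeriv_fderiv, hfd]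
    refine ih (hf.fderiv_right (by simp)) (hc.fderiv ℝ) (fun y => ?_) x
    rw [norm_iteratedFDeriv_fderiv]
    exact hS y

/-- Mollifiers `ρ_ε = ε^{-d} ρ(·/ε)` at all scales `0 < ε ≤ 1`; their derivatives are bounded by
powers of `1/ε`. -/
lemma exists_mollifier (μ : Measure E) [μ.IsAddHaarMeasure] :
    ∃ T : ℕ → ℝ, ∀ ε : ℝ, 0 < ε → ε ≤ 1 → ∃ ρ : E → ℝ, ContDiff ℝ ∞ ρ ∧
      Function.support ρ ⊆ Metric.ball 0 ε ∧ (∀ x, 0 ≤ ρ x) ∧ ∫ x, ρ x ∂μ = 1 ∧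
      ∀ k x, ‖iteratedFDeriv ℝ k ρ x‖ ≤ T k * (ε⁻¹) ^ (Module.finrank ℝ E + k) := by
  let b : ContDiffBump (0 : E) := ⟨1 / 2, 1, by norm_num, by norm_num⟩
  set ρ : E → ℝ := b.normed μ
  have hρ : ContDiff ℝ ∞ ρ := b.contDiff_normed
  have hcs : HasCompactSupport ρ := b.hasCompactSupport_normed
  have hT : ∀ k : ℕ, ∃ T : ℝ, ∀ x, ‖iteratedFDeriv ℝ k ρ x‖ ≤ T := fun k =>
    (hcs.iteratedFDeriv (𝕜 := ℝ) k).exists_bound_of_continuous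
      (hρ.continuous_iteratedFDeriv (by exact_mod_cast le_top))
  choose T hT using hT
  refine ⟨T, fun ε hε hε1 => ⟨fun x => (ε⁻¹) ^ Module.finrank ℝ E * ρ (ε⁻¹ • x), ?_, ?_, ?_, ?_, ?_⟩⟩
  · exact contDiff_const.mul (hρ.comp (contDiff_const_smul _))
  · intro x hx
    have : ε⁻¹ • x ∈ Function.support ρ := right_ne_zero_of_mul hx
    rw [b.support_normed_eq, mem_ball_zero_iff, norm_smul, norm_inv, Real.norm_of_nonneg hε.le,
      inv_mul_lt_iff₀ hε] at this
    rw [mem_ball_zero_iff]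
    simpa [b] using this
  · exact fun x => mul_nonneg (by positivity) (b.nonneg_normed _)
  · rw [integral_const_mul, Measure.integral_comp_smul, b.integral_normed, smul_eq_mul, mul_one,
      abs_of_pos (by positivity)]
    exact mul_inv_cancel₀ (by positivity)
  · intro k x
    have hk : (k : WithTop ℕ∞) ≤ ∞ := by exact_mod_cast le_top
    have hL := ContinuousLinearMap.iteratedFDeriv_comp_right (𝕜 := ℝ)
      (ε⁻¹ • ContinuousLinearMap.id ℝ E) hρ x hk
    have e : iteratedFDeriv ℝ k (fun x => (ε⁻¹) ^ Module.finrank ℝ E * ρ (ε⁻¹ • x)) x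
        = (ε⁻¹) ^ Module.finrank ℝ E •
          iteratedFDeriv ℝ k (ρ ∘ ⇑(ε⁻¹ • ContinuousLinearMap.id ℝ E)) x :=
      iteratedFDeriv_const_smul_apply (a := (ε⁻¹) ^ Module.finrank ℝ E)
        ((hρ.comp (contDiff_const_smul ε⁻¹)).of_le hk).contDiffAt
    have hε0 : 0 ≤ ε⁻¹ := by positivity
    rw [e, norm_smul, hL, Real.norm_of_nonneg (by positivity), pow_add]
    have h1 : ‖ε⁻¹ • ContinuousLinearMap.id ℝ E‖ ≤ ε⁻¹ := by
      rw [norm_smul, Real.norm_of_nonneg hε0]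
      exact mul_le_of_le_one_right hε0 ContinuousLinearMap.norm_id_le
    calc (ε⁻¹) ^ Module.finrank ℝ E *
          ‖(iteratedFDeriv ℝ k ρ ((ε⁻¹ • ContinuousLinearMap.id ℝ E) x)).compContinuousLinearMap
            fun _ => ε⁻¹ • ContinuousLinearMap.id ℝ E‖
        ≤ (ε⁻¹) ^ Module.finrank ℝ E * (T k * (ε⁻¹) ^ k) := by
          gcongr
          refine (ContinuousMultilinearMap.norm_compContinuousLinearMap_le _ _).trans ?_
          rw [Finset.prod_const, Finset.card_univ, Fintype.card_fin]
          gcongr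
          · exact (norm_nonneg _).trans (hT k x)
          · exact hT k _
      _ = _ := by ring

end Mollification

/-! ### Splitting off a bounded smooth part -/

lemma hasTemperateGrowth_of_bracket {F : Type*} [NormedAddCommGroup F] [NormedSpace ℝ F]
    {f : EuclideanSpace ℝ (Fin d) → F} (hf : ContDiff ℝ ∞ f)
    (h : ∀ k : ℕ, ∃ (C : ℝ) (K : ℕ), ∀ x, ‖iteratedFDeriv ℝ k f x‖ ≤ C * bracket x ^ K) :
    f.HasTemperateGrowth := by
  refine ⟨hf, fun k => ?_⟩
  obtain ⟨C, K, hC⟩ := h k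
  refine ⟨2 * K, |C|, fun x => (hC x).trans ?_⟩
  have hb := bracket_le_one_add_norm_sq x
  rw [pow_mul]
  exact mul_le_mul (le_abs_self C) (pow_le_pow_left₀ (bracket_pos x).le hb K)
    (pow_pos (bracket_pos x) K).le (abs_nonneg C)

lemma hasTemperateGrowth_outerCutoff (c : ℝ) : (outerCutoff d c).HasTemperateGrowth :=
  hasTemperateGrowth_of_bracket (contDiff_outerCutoff c) fun k =>
    let ⟨C, K, _, h⟩ := exists_norm_iteratedFDeriv_outerCutoff_le d k
    ⟨C, K, h c k le_rfl⟩

lemma hasTemperateGrowth_shell (j : ℕ) : (shell d j).HasTemperateGrowth :=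
  (hasTemperateGrowth_outerCutoff _).sub (hasTemperateGrowth_outerCutoff _)

/-- A function with `n + 1` derivatives bounded by `⟨x⟩^N` is the sum of a function from a bounded
subset of `𝓞_M` which depends on `n` and `N` only, and a function whose derivatives up to order `n`
are bounded by `5⟨x⟩`, independently of `N`. The part in the `j`-th shell is mollified at a scale
which is a negative power of `j`, so small that the error is bounded by `1`. -/
lemma exists_smooth_approx (d n N : ℕ) :
    ∃ (C : ℕ → ℝ) (A : ℕ → ℕ), ∀ f : EuclideanSpace ℝ (Fin d) → ℂ, ContDiff ℝ ∞ f →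
      (∀ k ≤ n + 1, ∀ x, ‖iteratedFDeriv ℝ k f x‖ ≤ bracket x ^ N) →
      ∃ g : EuclideanSpace ℝ (Fin d) → ℂ, g.HasTemperateGrowth ∧
        (∀ k x, ‖iteratedFDeriv ℝ k g x‖ ≤ C k * bracket x ^ A k) ∧
        ∀ k ≤ n, ∀ x, ‖iteratedFDeriv ℝ k (f - g) x‖ ≤ 5 * bracket x := by
  obtain ⟨C₀, K, hC₀, hsh⟩ := exists_norm_iteratedFDeriv_shell_le d (n + 1)
  obtain ⟨T, hT⟩ := exists_mollifier (volume : Measure (EuclideanSpace ℝ (Fin d)))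
  -- `S j` bounds the derivatives of order at most `n + 1` of the piece in the `j`-th shell, where
  -- `⟨x⟩ ≤ j + 2`; its inverse is the scale of the mollification.
  set M : ℝ := 2 ^ (n + 1) * C₀
  have hM : 1 ≤ M := one_le_mul_of_one_le_of_one_le (one_le_pow₀ (by norm_num)) hC₀
  set P := K + N
  set S : ℕ → ℝ := fun j => M * ((j : ℝ) + 2) ^ P with hSdef
  have hS1 : ∀ j, 1 ≤ S j := fun j => one_le_mul_of_one_le_of_one_le hM
    (one_le_pow₀ (by linarith [Nat.cast_nonneg (α := ℝ) j]))
  have hSpos : ∀ j, 0 < S j := fun j => one_pos.trans_le (hS1 j)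
  choose ρ hρc hρs hρ0 hρi hρT using
    fun j => hT (S j)⁻¹ (inv_pos.mpr (hSpos j)) (inv_le_one_of_one_le₀ (hS1 j))
  set v : ℝ := (volume : Measure (EuclideanSpace ℝ (Fin d))).real (Metric.closedBall 0 1)
  set e : ℕ → ℕ := fun k => Module.finrank ℝ (EuclideanSpace ℝ (Fin d)) + k + 1 with hedef
  have hv : 0 ≤ v := measureReal_nonneg
  refine ⟨fun k => 5 * (|T k| * v * (M * 7 ^ P) ^ e k), fun k => P * e k + 1,
    fun f hf hfb => ?_⟩
  set F : ℕ → EuclideanSpace ℝ (Fin d) → ℂ := fun j x => shell d j x • f x with hF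
  set G : ℕ → EuclideanSpace ℝ (Fin d) → ℂ := fun j =>
    convolution (ρ j) (F j) (ContinuousLinearMap.lsmul ℝ ℝ) volume with hG
  have hFc : ∀ j, ContDiff ℝ ∞ (F j) := fun j => (contDiff_shell j).smul hf
  have hFS : ∀ j, ∀ k ≤ n + 1, ∀ x, ‖iteratedFDeriv ℝ k (F j) x‖ ≤ S j := by
    intro j k hk x
    by_cases hx : bracket x ≤ j + 2
    · have hle : ((n + 1 : ℕ) : WithTop ℕ∞) ≤ ∞ := by exact_mod_cast le_top
      refine (norm_iteratedFDeriv_smul_le_of_le ((contDiff_shell j).of_le hle)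
        (hf.of_le hle) (fun i hi => hsh j i hi x) (fun i hi => hfb i hi x) k hk).trans ?_
      have hb := (bracket_pos x).le
      calc 2 ^ (n + 1) * (C₀ * bracket x ^ K) * bracket x ^ N = M * bracket x ^ P := by
            simp only [M, P, pow_add]; ring
        _ ≤ S j := by simp only [hSdef]; gcongr
    · rw [iteratedFDeriv_eq_zero_of_bracket (isOpen_Ioi (a := (j : ℝ) + 2)) (fun y hy => ?_) k
        (not_le.mp hx)]
      · simpa using (hSpos j).le
      · simp [hF, shell_eq_zero_of_ge (le_of_lt (Set.mem_Ioi.mp hy))]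
  have hFcs : ∀ j, HasCompactSupport (F j) := by
    intro j
    refine HasCompactSupport.of_support_subset_isCompact
      (isCompact_closedBall (0 : EuclideanSpace ℝ (Fin d)) (j + 2)) fun x hx => ?_
    rw [mem_closedBall_zero_iff]
    by_contra! h
    refine hx ?_
    have h0 : (0 : ℝ) ≤ j := Nat.cast_nonneg j
    have : (j : ℝ) + 2 ≤ bracket x := by unfold bracket; nlinarith
    simp [hF, shell_eq_zero_of_ge this]
  have hF0 : ∀ (j : ℕ) x, 3 * bracket x ≤ j → F j x = 0 := by
    intro j x hx
    simp [hF, shell_eq_zero_of_le (show bracket x ≤ j by linarith [bracket_pos x])]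
  -- Mollification at a scale of at most `1` moves the support by at most `1`, which the factor `3`
  -- in the definition of `locSum` allows for.
  have hGc : ∀ j, ContDiff ℝ ∞ (G j) := fun j =>
    (hFcs j).contDiff_convolution_right (n := ⊤) _ (hρc j).continuous.locallyIntegrable (hFc j)
  have hG0 : ∀ (j : ℕ) x, 3 * bracket x ≤ j → G j x = 0 := by
    intro j x hx
    have : ∀ t, ρ j t • F j (x - t) = 0 := by
      intro t
      by_cases ht : ρ j t = 0
      · rw [ht, zero_smul]
      have ht1 := mem_ball_zero_iff.mp (hρs j ht)
      have ht2 : ‖t‖ ≤ 1 := ht1.le.trans (inv_le_one_of_one_le₀ (hS1 j))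
      have hxt : bracket (x - t) ≤ j := by
        refine le_trans ?_ hx
        have := norm_sub_le x t
        unfold bracket
        nlinarith [norm_nonneg (x - t), norm_nonneg x, sq_nonneg (‖x‖ - 1)]
      simp [hF, shell_eq_zero_of_le hxt]
    simp only [hG, convolution_def, ContinuousLinearMap.lsmul_apply, this, integral_zero]
  have hGb : ∀ k x, ‖iteratedFDeriv ℝ k (locSum G) x‖
      ≤ 5 * (|T k| * v * (M * 7 ^ P) ^ e k) * bracket x ^ (P * e k + 1) := by
    intro k x
    have hb := one_le_bracket x
    refine (norm_iteratedFDeriv_locSum_le hG0 hGc k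
      (B := |T k| * v * (M * 7 ^ P * bracket x ^ P) ^ e k) (by positivity)
      fun j hj => ?_).trans (le_of_eq ?_)
    · -- All derivatives are put on the mollifier, and only the sup norm of `F j` enters.
      have hflip : G j = convolution (F j) (ρ j) (ContinuousLinearMap.lsmul ℝ ℝ).flip volume :=
        (convolution_flip _).symm
      have hts : tsupport (ρ j) ⊆ Metric.closedBall 0 1 :=
        closure_minimal ((hρs j).trans (Metric.ball_subset_closedBall.trans
          (Metric.closedBall_subset_closedBall (inv_le_one_of_one_le₀ (hS1 j)))))
          Metric.isClosed_closedBall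
      rw [hflip]
      refine (norm_iteratedFDeriv_convolution_le (hFc j).continuous.locallyIntegrable
        (S := S j) (fun y => by simpa using hFS j 0 (Nat.zero_le _) y) k _
        (by rw [ContinuousLinearMap.opNorm_flip]; exact ContinuousLinearMap.opNorm_lsmul_le)
        (hρc j) hts (hρT j k) x).trans ?_
      rw [inv_inv]
      have hSj : S j ≤ M * 7 ^ P * bracket x ^ P := by
        rw [mul_assoc, ← mul_pow]
        refine mul_le_mul_of_nonneg_left (pow_le_pow_left₀ (by positivity) ?_ P) (by positivity)
        linarith
      have hS0 := (hSpos j).le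
      calc S j * (T k * S j ^ (Module.finrank ℝ (EuclideanSpace ℝ (Fin d)) + k)) * v
          = T k * v * S j ^ e k := by simp only [hedef]; ring
        _ ≤ |T k| * v * (M * 7 ^ P * bracket x ^ P) ^ e k := by
            gcongr
            exact le_abs_self _
    · rw [mul_pow, ← pow_mul]; ring
  refine ⟨locSum G, hasTemperateGrowth_of_bracket (contDiff_locSum hG0 hGc)
    fun k => ⟨_, _, hGb k⟩, hGb, fun k hk x => ?_⟩
  have hsub : f - locSum G = locSum fun j => F j - G j := by
    conv_lhs => rw [← locSum_shell_smul f]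
    funext y
    simp only [locSum, Pi.sub_apply, Finset.sum_sub_distrib, hF]
  rw [hsub]
  refine (norm_iteratedFDeriv_locSum_le (fun j y hy => ?_) (fun j => (hFc j).sub (hGc j)) k
    zero_le_one fun j _ => ?_).trans (mul_one _).le
  · rw [hF0 j y hy, hG0 j y hy, sub_zero]
  · refine (norm_iteratedFDeriv_sub_convolution_le (inv_pos.mpr (hSpos j)) (hρs j) (hρ0 j)
      (hρi j) (hρc j).continuous k (hFc j) (hFcs j) (hFS j (k + 1) (by omega)) x).trans ?_
    exact (inv_mul_cancel₀ (hSpos j).ne').le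

/-! ### Neighbourhoods given by rapidly decreasing functions -/

/-- A rapidly decreasing sequence is dominated, shell by shell, by a Schwartz function. -/
lemma exists_schwartzMap_ge (d : ℕ) {β : ℕ → ℝ} (hβ0 : ∀ j, 0 ≤ β j)
    (hβ : ∀ p : ℕ, ∃ C : ℝ, ∀ j : ℕ, ((j : ℝ) + 1) ^ p * β j ≤ C) :
    ∃ φ : 𝓢(EuclideanSpace ℝ (Fin d), ℂ), ∀ (j : ℕ) x, (j : ℝ) ≤ bracket x →
      bracket x ≤ j + 2 → β j ≤ ‖φ x‖ := by
  -- On the `j`-th shell only the neighbouring functions of the partition of unity are nonzero, so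
  -- the sum of three neighbouring terms is a coefficient that works for each of them.
  set γ : ℕ → ℝ := fun i => β (i - 1) + β i + β (i + 1) with hγdef
  have hγ0 : ∀ i, 0 ≤ γ i := fun i => add_nonneg (add_nonneg (hβ0 _) (hβ0 _)) (hβ0 _)
  have hγ : ∀ p : ℕ, ∃ C : ℝ, 0 ≤ C ∧ ∀ i : ℕ, ((i : ℝ) + 1) ^ p * γ i ≤ C := by
    intro p
    obtain ⟨C, hC⟩ := hβ p
    have hC0 : 0 ≤ C := le_trans (mul_nonneg (by positivity) (hβ0 0)) (hC 0)
    refine ⟨2 ^ p * C + C + C, by positivity, fun i => ?_⟩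
    have hi : (i : ℝ) + 1 ≤ 2 * ((((i - 1 : ℕ) : ℝ)) + 1) := by
      exact_mod_cast (show i + 1 ≤ 2 * ((i - 1) + 1) by omega)
    have h1 : ((i : ℝ) + 1) ^ p * β (i - 1) ≤ 2 ^ p * C := by
      calc ((i : ℝ) + 1) ^ p * β (i - 1)
          ≤ (2 * ((((i - 1 : ℕ) : ℝ)) + 1)) ^ p * β (i - 1) := by
            gcongr
            exact hβ0 _
        _ = 2 ^ p * (((((i - 1 : ℕ) : ℝ)) + 1) ^ p * β (i - 1)) := by rw [mul_pow]; ring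
        _ ≤ 2 ^ p * C := by gcongr; exact hC _
    have h2 : ((i : ℝ) + 1) ^ p * β (i + 1) ≤ C := by
      refine le_trans ?_ (hC (i + 1))
      gcongr
      · exact hβ0 _
      · linarith
    simp only [hγdef, mul_add]
    linarith [hC i]
  set F : ℕ → EuclideanSpace ℝ (Fin d) → ℂ := fun i x => shell d i x • (γ i : ℂ) with hF
  have hFc : ∀ i, ContDiff ℝ ∞ (F i) := fun i => (contDiff_shell i).smul contDiff_const
  have hF0 : ∀ (i : ℕ) x, 3 * bracket x ≤ i → F i x = 0 := by
    intro i x hx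
    simp [hF, shell_eq_zero_of_le (show bracket x ≤ i by linarith [bracket_pos x])]
  have hdecay : ∀ p k : ℕ, ∃ C : ℝ, ∀ x, ‖x‖ ^ p * ‖iteratedFDeriv ℝ k (locSum F) x‖ ≤ C := by
    intro p k
    obtain ⟨C, K, hC1, hC⟩ := exists_norm_iteratedFDeriv_shell_le d k
    obtain ⟨D, hD0, hD⟩ := hγ (K + p + 1)
    refine ⟨5 * (2 ^ k * C * (2 ^ (K + p + 1) * D)), fun x => ?_⟩
    have hb := bracket_pos x
    have hxb : ‖x‖ ≤ bracket x := by unfold bracket; nlinarith [sq_nonneg (‖x‖ - 1)]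
    set B : ℝ := 2 ^ k * C * (2 ^ (K + p + 1) * D) / bracket x ^ (p + 1) with hB
    have hB0 : 0 ≤ B := by positivity
    have h := norm_iteratedFDeriv_locSum_le hF0 hFc k (x := x) hB0 fun i _ => by
      by_cases hx : bracket x ≤ i + 2
      · have hle : (k : WithTop ℕ∞) ≤ ∞ := by exact_mod_cast le_top
        refine (norm_iteratedFDeriv_smul_le_of_le (B := γ i) ((contDiff_shell i).of_le hle)
          contDiff_const (fun l hl => hC i l hl x) (fun l hl => ?_) k le_rfl).trans ?_
        · cases l with
          | zero => simp [abs_of_nonneg (hγ0 i)]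
          | succ l => simpa [iteratedFDeriv_const_of_ne (𝕜 := ℝ) l.succ_ne_zero] using hγ0 i
        · rw [hB, le_div_iff₀ (by positivity)]
          have h2 : bracket x ^ (K + p + 1) ≤ (2 * ((i : ℝ) + 1)) ^ (K + p + 1) := by
            gcongr
            linarith [Nat.cast_nonneg (α := ℝ) i]
          calc 2 ^ k * (C * bracket x ^ K) * γ i * bracket x ^ (p + 1)
              = 2 ^ k * C * (bracket x ^ (K + p + 1) * γ i) := by ring
            _ ≤ 2 ^ k * C * ((2 * ((i : ℝ) + 1)) ^ (K + p + 1) * γ i) := by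
                gcongr
                exact hγ0 i
            _ = 2 ^ k * C * (2 ^ (K + p + 1) * (((i : ℝ) + 1) ^ (K + p + 1) * γ i)) := by
                rw [mul_pow]; ring
            _ ≤ 2 ^ k * C * (2 ^ (K + p + 1) * D) := by gcongr; exact hD i
      · rw [iteratedFDeriv_eq_zero_of_bracket (isOpen_Ioi (a := (i : ℝ) + 2)) (fun y hy => ?_) k
          (not_le.mp hx)]
        · simpa using hB0
        · simp [hF, shell_eq_zero_of_ge (le_of_lt (Set.mem_Ioi.mp hy))]
    calc ‖x‖ ^ p * ‖iteratedFDeriv ℝ k (locSum F) x‖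
        ≤ bracket x ^ p * (5 * bracket x * B) := by gcongr
      _ = 5 * (B * bracket x ^ (p + 1)) := by ring
      _ = 5 * (2 ^ k * C * (2 ^ (K + p + 1) * D)) := by
          rw [hB, div_mul_cancel₀ _ (by positivity)]
  refine ⟨⟨locSum F, contDiff_locSum hF0 hFc, hdecay⟩, fun j x hj1 hj2 => ?_⟩
  change β j ≤ ‖locSum F x‖
  set J := ⌈3 * bracket x⌉₊
  have hsum := sum_shell_add_outerCutoff J x
  rw [outerCutoff_eq_zero (by linarith [Nat.le_ceil (3 * bracket x), bracket_pos x]),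
    add_zero] at hsum
  have e : locSum F x = ((∑ i ∈ Finset.range J, shell d i x * γ i : ℝ) : ℂ) := by
    simp [locSum, hF, J]
  have hle : β j ≤ ∑ i ∈ Finset.range J, shell d i x * γ i := by
    calc β j = ∑ i ∈ Finset.range J, shell d i x * β j := by rw [← Finset.sum_mul, hsum, one_mul]
      _ ≤ _ := by
        refine Finset.sum_le_sum fun i _ => ?_
        by_cases h1 : bracket x ≤ i
        · rw [shell_eq_zero_of_le h1]; simp
        by_cases h2 : (i : ℝ) + 2 ≤ bracket x
        · rw [shell_eq_zero_of_ge h2]; simp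
        refine mul_le_mul_of_nonneg_left ?_ (shell_nonneg i x)
        have h3 : i < j + 2 := by exact_mod_cast (not_le.mp h1).trans_le hj2
        have h4 : j < i + 2 := by exact_mod_cast hj1.trans_lt (not_le.mp h2)
        have h5 := hβ0 (i - 1)
        have h6 := hβ0 i
        have h7 := hβ0 (i + 1)
        obtain h | h | h : j = i - 1 ∨ j = i ∨ j = i + 1 := by omega
        all_goals simp only [hγdef, h] at *; linarith
  rw [e, Complex.norm_real]
  exact hle.trans (le_abs_self _)

/-- Multiplication of an element of `𝓞_M` by a real function of the same kind. -/
noncomputable def mulOM {u : EuclideanSpace ℝ (Fin d) → ℝ} (hu : u.HasTemperateGrowth) (f : OM d) : OM d :=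
  ⟨fun x => u x • f.1 x, hu.smul f.2⟩

/-- The forgetful map from `𝓞_M` to functions. -/
noncomputable def omVal (d : ℕ) : OM d →ₗ[ℝ] (EuclideanSpace ℝ (Fin d) → ℂ) where
  toFun f := f.1
  map_add' _ _ := rfl
  map_smul' _ _ := rfl

lemma OM.contDiff (f : OM d) (n : ℕ) : ContDiff ℝ n f.1 :=
  f.2.1.of_le (by exact_mod_cast le_top)

lemma iteratedFDeriv_real_smul (c : ℝ) (f : OM d) (k : ℕ) (x : EuclideanSpace ℝ (Fin d)) :
    iteratedFDeriv ℝ k (c • f).1 x = c • iteratedFDeriv ℝ k f.1 x :=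
  iteratedFDeriv_const_smul_apply (f.contDiff k).contDiffAt

lemma _root_.Convex.sum_smul_mem_of_sum_le_one {E ι : Type*} [AddCommGroup E] [Module ℝ E]
    {V : Set E} (hV : Convex ℝ V) (h0 : (0 : E) ∈ V) {s : Finset ι} {w : ι → ℝ} {v : ι → E}
    (hw : ∀ i ∈ s, 0 ≤ w i) (hw1 : ∑ i ∈ s, w i ≤ 1) (hv : ∀ i ∈ s, v i ∈ V) :
    ∑ i ∈ s, w i • v i ∈ V := by
  rcases (Finset.sum_nonneg hw).eq_or_lt with h | h
  · rw [Finset.sum_eq_zero fun i hi => ?_]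
    · exact h0
    · rw [(Finset.sum_eq_zero_iff_of_nonneg hw).mp h.symm i hi, zero_smul]
  · have h1 := hV.centerMass_mem hw h hv
    have h2 := hV.smul_mem_of_zero_mem h0 h1 ⟨h.le, hw1⟩
    rwa [Finset.centerMass, smul_inv_smul₀ h.ne'] at h2

lemma sum_range_inv_mul_succ_le (J : ℕ) :
    ∑ j ∈ Finset.range J, (((j : ℝ) + 1) * (j + 2))⁻¹ ≤ 1 := by
  have : ∑ j ∈ Finset.range J, (((j : ℝ) + 1) * (j + 2))⁻¹ = 1 - ((J : ℝ) + 1)⁻¹ := by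
    induction J with
    | zero => simp
    | succ J ih =>
      rw [Finset.sum_range_succ, ih]
      have h1 : (J : ℝ) + 1 ≠ 0 := by positivity
      have h2 : (J : ℝ) + 2 ≠ 0 := by positivity
      have h3 : (J : ℝ) + 1 + 1 ≠ 0 := by positivity
      push_cast
      field_simp
      ring
  rw [this]
  have : 0 ≤ ((J : ℝ) + 1)⁻¹ := by positivity
  linarith

/-- If `a j` is at least a multiple of `(j + 1)^p` for large `j`, then `(j + 1)^p / a j` is
bounded. -/
lemma exists_pow_mul_inv_le {a : ℕ → ℝ} {p : ℕ}
    (h : ∃ c : ℝ, 0 < c ∧ ∃ j₀ : ℕ, ∀ j ≥ j₀, c * ((j : ℝ) + 1) ^ p ≤ a j) :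
    ∃ C : ℝ, ∀ j : ℕ, ((j : ℝ) + 1) ^ p * (a j)⁻¹ ≤ C := by
  obtain ⟨c, hc, j₀, h⟩ := h
  have hb : BddAbove (Set.range fun j : ℕ => ((j : ℝ) + 1) ^ p * (a j)⁻¹) := by
    refine Filter.IsBoundedUnder.bddAbove_range ⟨c⁻¹, ?_⟩
    rw [Filter.eventually_map]
    filter_upwards [Filter.eventually_ge_atTop j₀] with j hj
    have hpos : 0 < c * ((j : ℝ) + 1) ^ p := by positivity
    rw [← div_eq_mul_inv, div_le_iff₀ (hpos.trans_le (h j hj)), inv_mul_eq_div, le_div_iff₀ hc,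
      mul_comm]
    exact h j hj
  obtain ⟨C, hC⟩ := hb
  exact ⟨C, fun j => hC (Set.mem_range_self j)⟩

/-- A convex set which contains a multiple of the trace of every unit ball of
`X_{n,N}`, `N ∈ ℕ`, contains a neighbourhood of zero given by Schwartz's seminorms of order at
most `n`. The function is decomposed along the shells: each piece lies in a multiple of the set
because of the choice of the weight `φ`, which on the `j`-th shell makes use of the balls with
`N ≤ j`, and the part outside a large ball lies in the set because it is small in some
`X_{n,N}`. -/
lemma exists_schwartzMap_of_absorbs {V : Set (OM d)} (hconv : Convex ℝ V) {n : ℕ}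
    (hV : ∀ N : ℕ, ∃ ε > 0, ∀ f : OM d,
      (∀ k ≤ n, ∀ x, ‖iteratedFDeriv ℝ k f.1 x‖ ≤ ε * bracket x ^ N) → f ∈ V) :
    ∃ φ : 𝓢(EuclideanSpace ℝ (Fin d), ℂ), ∀ f : OM d,
      (∀ k ≤ n, ∀ x, ‖φ x‖ * ‖iteratedFDeriv ℝ k f.1 x‖ ≤ 1) → f ∈ V := by
  choose ε hε hεV using hV
  obtain ⟨C₁, K₁, hC₁, hsh⟩ := exists_norm_iteratedFDeriv_shell_le d n
  obtain ⟨C₂, K₂, hC₂, hcut⟩ := exists_norm_iteratedFDeriv_outerCutoff_le d n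
  set M : ℝ := 2 ^ n * C₁
  have hM : 0 < M := by positivity
  set w : ℕ → ℝ := fun j => (((j : ℝ) + 1) * (j + 2))⁻¹ with hwdef
  have hw : ∀ j, 0 < w j := fun j => by positivity
  -- On the `j`-th shell `⟨x⟩ ≥ (j + 1) / 2`. A bound `t j N` there for the derivatives of `f` makes
  -- the norm in `X_{n,N}` of `2 / w j` times the `j`-th piece at most `ε N`.
  set t : ℕ → ℕ → ℝ := fun j N =>
    w j / 2 * ε N * (((j : ℝ) + 1) / 2) ^ N / (M * ((j : ℝ) + 2) ^ K₁) with htdef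
  have htpos : ∀ j N, 0 < t j N := fun j N => by
    have := hw j
    have := hε N
    positivity
  have hmax : ∀ j, ∃ N ∈ Finset.range (j + 1), ∀ N' ∈ Finset.range (j + 1), t j N' ≤ t j N :=
    fun j => Finset.exists_max_image _ _ ⟨0, by simp⟩
  choose m hm hmt using hmax
  set a : ℕ → ℝ := fun j => t j (m j) with hadef
  have ha : ∀ j, 0 < a j := fun j => htpos j _
  have hrapid : ∀ p : ℕ, ∃ C : ℝ, ∀ j : ℕ, ((j : ℝ) + 1) ^ p * (a j)⁻¹ ≤ C := by
    intro p
    refine exists_pow_mul_inv_le ?_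
    -- The summand `2` compensates the weight `w j`, and `K₁` the growth of the partition of unity.
    set N := p + 2 + K₁
    refine ⟨ε N / (2 ^ N * 4 * M * 2 ^ K₁), by have := hε N; positivity, N, fun j hj => ?_⟩
    refine le_trans ?_ (hmt j N (Finset.mem_range.mpr (Nat.lt_succ_of_le hj)))
    have hj0 : (0 : ℝ) ≤ j := Nat.cast_nonneg j
    have hεN := hε N
    have hwj : (2 * ((j : ℝ) + 1) ^ 2)⁻¹ ≤ w j := by
      exact inv_anti₀ (by positivity) (by nlinarith)
    calc ε N / (2 ^ N * 4 * M * 2 ^ K₁) * ((j : ℝ) + 1) ^ p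
        = (2 * ((j : ℝ) + 1) ^ 2)⁻¹ / 2 * ε N * (((j : ℝ) + 1) / 2) ^ N
          / (M * (2 * ((j : ℝ) + 1)) ^ K₁) := by
          have h1 : (j : ℝ) + 1 ≠ 0 := by positivity
          rw [div_pow, mul_pow, show ((j : ℝ) + 1) ^ N
            = ((j : ℝ) + 1) ^ p * ((j : ℝ) + 1) ^ 2 * ((j : ℝ) + 1) ^ K₁ by
              simp only [N, pow_add]]
          field_simp
          norm_num
      _ ≤ t j N := by
          simp only [htdef]
          gcongr
          linarith
  obtain ⟨φ, hφ⟩ := exists_schwartzMap_ge d (fun j => (inv_pos.mpr (ha j)).le) hrapid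
  refine ⟨φ, fun f hf => ?_⟩
  have hfa : ∀ (j : ℕ) x, (j : ℝ) ≤ bracket x → bracket x ≤ j + 2 → ∀ k ≤ n,
      ‖iteratedFDeriv ℝ k f.1 x‖ ≤ a j := by
    intro j x h1 h2 k hk
    have h3 := (mul_le_mul_of_nonneg_right (hφ j x h1 h2) (norm_nonneg _)).trans (hf k hk x)
    rwa [inv_mul_le_iff₀ (ha j), mul_one] at h3
  have h0V : (0 : OM d) ∈ V := by
    refine hεV 0 0 fun k _ x => ?_
    have : iteratedFDeriv ℝ k (0 : OM d).1 x = 0 := by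
      change iteratedFDeriv ℝ k (fun _ => (0 : ℂ)) x = 0
      simp
    rw [this, norm_zero]
    exact mul_nonneg (hε 0).le (by simp)
  have hpiece : ∀ j : ℕ, (2 * (w j)⁻¹) • mulOM (hasTemperateGrowth_shell j) f ∈ V := by
    intro j
    refine hεV (m j) _ fun k hk x => ?_
    have hb := one_le_bracket x
    rw [iteratedFDeriv_real_smul]
    by_cases h1 : bracket x < j
    · rw [iteratedFDeriv_eq_zero_of_bracket (isOpen_Iio (a := (j : ℝ))) (fun y hy => ?_) k h1,
        smul_zero, norm_zero]
      · exact mul_nonneg (hε _).le (by positivity)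
      · simp [mulOM, shell_eq_zero_of_le (le_of_lt (Set.mem_Iio.mp hy))]
    by_cases h2 : (j : ℝ) + 2 < bracket x
    · rw [iteratedFDeriv_eq_zero_of_bracket (isOpen_Ioi (a := (j : ℝ) + 2)) (fun y hy => ?_) k h2,
        smul_zero, norm_zero]
      · exact mul_nonneg (hε _).le (by positivity)
      · simp [mulOM, shell_eq_zero_of_ge (le_of_lt (Set.mem_Ioi.mp hy))]
    have hle : (n : WithTop ℕ∞) ≤ ∞ := by exact_mod_cast le_top
    have hder := norm_iteratedFDeriv_smul_le_of_le ((contDiff_shell j).of_le hle)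
      (f.contDiff n) (fun l hl => hsh j l hl x) (hfa j x (not_lt.mp h1) (not_lt.mp h2)) k hk
    have hwj := hw j
    have haj := ha j
    have hεj := hε (m j)
    rw [norm_smul, Real.norm_of_nonneg (by positivity)]
    calc 2 * (w j)⁻¹ * ‖iteratedFDeriv ℝ k (mulOM (hasTemperateGrowth_shell j) f).1 x‖
        ≤ 2 * (w j)⁻¹ * (2 ^ n * (C₁ * bracket x ^ K₁) * a j) := by gcongr; exact hder
      _ ≤ 2 * (w j)⁻¹ * (2 ^ n * (C₁ * ((j : ℝ) + 2) ^ K₁) * a j) := by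
          gcongr
          exact not_lt.mp h2
      _ = ε (m j) * (((j : ℝ) + 1) / 2) ^ m j := by
          simp only [hadef, htdef, M]
          field_simp
      _ ≤ ε (m j) * bracket x ^ m j := by
          gcongr
          linarith [not_lt.mp h1]
  -- The outer part is measured with one power of `⟨x⟩` more than needed, which makes it small.
  obtain ⟨N, -, C, hC⟩ := mem_lbSubmodule_of_mem_omSubmodule n f.2
  obtain ⟨J, hJ⟩ := exists_nat_gt (2 * (2 ^ n * C₂ * |C|) / ε (K₂ + N + 1))
  have htail : (2 : ℝ) • mulOM (hasTemperateGrowth_outerCutoff ((J : ℝ) - 1)) f ∈ V := by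
    refine hεV (K₂ + N + 1) _ fun k hk x => ?_
    have hb := one_le_bracket x
    have hεN := hε (K₂ + N + 1)
    rw [iteratedFDeriv_real_smul]
    by_cases h1 : bracket x < J
    · rw [iteratedFDeriv_eq_zero_of_bracket (isOpen_Iio (a := (J : ℝ))) (fun y hy => ?_) k h1,
        smul_zero, norm_zero]
      · positivity
      · have : bracket y ≤ (J : ℝ) - 1 + 1 := by linarith [Set.mem_Iio.mp hy]
        simp [mulOM, outerCutoff_eq_zero this]
    have hle : (n : WithTop ℕ∞) ≤ ∞ := by exact_mod_cast le_top
    have hder := norm_iteratedFDeriv_smul_le_of_le ((contDiff_outerCutoff ((J : ℝ) - 1)).of_le hle)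
      (f.contDiff n) (fun l hl => hcut _ l hl x) (B := |C| * bracket x ^ N)
      (fun l hl => (hC l hl x).trans (by gcongr; exact le_abs_self C)) k hk
    rw [div_lt_iff₀ hεN] at hJ
    rw [norm_smul, Real.norm_of_nonneg (by positivity)]
    calc 2 * ‖iteratedFDeriv ℝ k
          (mulOM (hasTemperateGrowth_outerCutoff ((J : ℝ) - 1)) f).1 x‖
        ≤ 2 * (2 ^ n * (C₂ * bracket x ^ K₂) * (|C| * bracket x ^ N)) := by gcongr; exact hder
      _ = 2 * (2 ^ n * C₂ * |C|) * bracket x ^ (K₂ + N) := by ring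
      _ ≤ (bracket x * ε (K₂ + N + 1)) * bracket x ^ (K₂ + N) := by
          refine mul_le_mul_of_nonneg_right ?_ (by positivity)
          exact hJ.le.trans (mul_le_mul_of_nonneg_right (not_lt.mp h1) hεN.le)
      _ = ε (K₂ + N + 1) * bracket x ^ (K₂ + N + 1) := by ring
  have hsum : ∑ j ∈ Finset.range J, w j •
      ((2 * (w j)⁻¹) • mulOM (hasTemperateGrowth_shell j) f) ∈ V :=
    hconv.sum_smul_mem_of_sum_le_one h0V (fun j _ => (hw j).le) (sum_range_inv_mul_succ_le J)
      fun j _ => hpiece j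
  have hfin := hconv hsum htail (a := 1 / 2) (b := 1 / 2) (by norm_num) (by norm_num) (by norm_num)
  convert hfin using 1
  have hinj : Function.Injective (omVal d) := Subtype.val_injective
  refine hinj (funext fun x => ?_)
  have hx := sum_shell_add_outerCutoff J x
  simp only [map_add, map_smul, map_sum, Pi.add_apply, Pi.smul_apply, Finset.sum_apply, smul_smul]
  change f.1 x = _
  calc f.1 x = (∑ j ∈ Finset.range J, shell d j x + outerCutoff d ((J : ℝ) - 1) x) • f.1 x := by
        rw [hx, one_smul]
    _ = _ := by
        rw [add_smul, Finset.sum_smul, Finset.smul_sum]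
        congr 1
        · refine Finset.sum_congr rfl fun j _ => ?_
          have : w j ≠ 0 := (hw j).ne'
          rw [smul_smul, show (1 / 2 : ℝ) * (w j * (2 * (w j)⁻¹)) = 1 by field_simp, one_smul]
          rfl
        · rw [show (1 / 2 : ℝ) * 2 = 1 by norm_num, one_smul]
          rfl

/-! ### The inductive limit topology of `X_n` -/

instance (d n : ℕ) : IsScalarTower ℝ ℂ (LBSpace d n) :=
  inferInstanceAs (IsScalarTower ℝ ℂ ↥(lbSubmodule d n))

instance (d n : ℕ) : IsTopologicalAddGroup (LBSpace d n) :=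
  topologicalAddGroup_sInf fun _ ht => ht.1

instance (d n : ℕ) : ContinuousSMul ℂ (LBSpace d n) :=
  continuousSMul_sInf fun _ ht => ht.2.1

instance (d n : ℕ) : LocallyConvexSpace ℝ (LBSpace d n) :=
  LocallyConvexSpace.sInf fun _ ht => ht.2.2.1

lemma continuous_stepInclusion (d n N : ℕ) : Continuous (stepInclusion d n N) :=
  continuous_sInf_rng.mpr fun _ ht => ht.2.2.2 N

lemma withSeminorms_stepNorm (d n N : ℕ) : WithSeminorms fun _ : Unit => stepNorm d n N := by
  have : IsTopologicalAddGroup (StepSpace d n N) :=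
    letI := (stepNorm d n N).toSeminormedAddCommGroup
    inferInstanceAs (IsTopologicalAddGroup (StepSpace d n N))
  rw [SeminormFamily.withSeminorms_iff_topologicalSpace_eq_iInf, iInf_unique]
  rfl

lemma stepNorm_le {n N : ℕ} {f : StepSpace d n N} {C : ℝ}
    (h : ∀ k ≤ n, ∀ x, ‖iteratedFDeriv ℝ k f.1 x‖ ≤ C * bracket x ^ N) :
    stepNorm d n N f ≤ C := by
  refine ciSup_le fun p => ?_
  rw [inv_mul_le_iff₀ (pow_pos (bracket_pos p.2) N), mul_comm]
  exact h _ (Nat.lt_succ_iff.mp p.1.2) _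

lemma norm_iteratedFDeriv_le_stepNorm {n N : ℕ} (f : StepSpace d n N) {k : ℕ} (hk : k ≤ n)
    (x : EuclideanSpace ℝ (Fin d)) :
    ‖iteratedFDeriv ℝ k f.1 x‖ ≤ stepNorm d n N f * bracket x ^ N := by
  have h := le_ciSup (bddAbove_stepNorm f) (⟨k, Nat.lt_succ_of_le hk⟩, x)
  rw [inv_mul_le_iff₀ (pow_pos (bracket_pos x) N), mul_comm] at h
  exact h

/-- A neighbourhood of zero in `X_n` contains a multiple of the unit ball of each `X_{n,N}`. -/
lemma exists_of_mem_nhds_zero {n : ℕ} {W : Set (LBSpace d n)} (hW : W ∈ 𝓝 (0 : LBSpace d n))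
    (N : ℕ) : ∃ ε > 0, ∀ f : StepSpace d n N, stepNorm d n N f ≤ ε → stepInclusion d n N f ∈ W := by
  have h : (stepInclusion d n N) ⁻¹' W ∈ 𝓝 (0 : StepSpace d n N) :=
    (continuous_stepInclusion d n N).continuousAt.preimage_mem_nhds (by rwa [map_zero])
  obtain ⟨s, r, hr, hs⟩ := ((withSeminorms_stepNorm d n N).mem_nhds_iff 0 _).mp h
  refine ⟨r / 2, by positivity, fun f hf => hs ?_⟩
  have hle : s.sup (fun _ : Unit => stepNorm d n N) ≤ stepNorm d n N :=
    Finset.sup_le fun _ _ => le_rfl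
  rw [Seminorm.mem_ball_zero]
  linarith [hle f]

lemma exists_bracket_pow_mul_le (φ : 𝓢(EuclideanSpace ℝ (Fin d), ℂ)) (N : ℕ) :
    ∃ S : ℝ, ∀ x, ‖φ x‖ * bracket x ^ N ≤ S := by
  have h := fun x => φ.one_add_le_sup_seminorm_apply (𝕜 := ℂ) (m := (2 * N, 0)) (k := 2 * N)
    (n := 0) le_rfl le_rfl x
  refine ⟨_, fun x => le_trans ?_ (h x)⟩
  have hb := bracket_le_one_add_norm_sq x
  rw [norm_iteratedFDeriv_zero, mul_comm, pow_mul]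
  gcongr
  exact (bracket_pos x).le

/-- A polynomial bound on a derivative gives a bound for the corresponding Schwartz seminorm. -/
lemma exists_mul_norm_iteratedFDeriv_le (φ : 𝓢(EuclideanSpace ℝ (Fin d), ℂ)) (k N : ℕ) :
    ∃ S : ℝ, 0 ≤ S ∧ ∀ (f : EuclideanSpace ℝ (Fin d) → ℂ) (C : ℝ),
      (∀ x, ‖iteratedFDeriv ℝ k f x‖ ≤ C * bracket x ^ N) →
      ∀ x, ‖φ x‖ * ‖iteratedFDeriv ℝ k f x‖ ≤ S * C := by
  obtain ⟨S, hS⟩ := exists_bracket_pow_mul_le φ N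
  have hS0 : 0 ≤ S := le_trans
    (mul_nonneg (norm_nonneg _) (pow_nonneg (bracket_pos _).le _)) (hS 0)
  refine ⟨S, hS0, fun f C hf x => ?_⟩
  have hC : 0 ≤ C := nonneg_of_mul_nonneg_left ((norm_nonneg _).trans (hf x))
    (pow_pos (bracket_pos x) N)
  calc ‖φ x‖ * ‖iteratedFDeriv ℝ k f x‖ ≤ ‖φ x‖ * (C * bracket x ^ N) := by
        gcongr; exact hf x
    _ = (‖φ x‖ * bracket x ^ N) * C := by ring
    _ ≤ S * C := by gcongr; exact hS x

lemma bddAbove_lbSeminorm (φ : 𝓢(EuclideanSpace ℝ (Fin d), ℂ)) {k : ℕ} (f : LBSpace d k) :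
    BddAbove (Set.range fun x => ‖φ x‖ * ‖iteratedFDeriv ℝ k f.1 x‖) := by
  obtain ⟨N, -, C, hC⟩ := f.2
  obtain ⟨S, -, hS⟩ := exists_mul_norm_iteratedFDeriv_le φ k N
  refine ⟨S * C, ?_⟩
  rintro _ ⟨x, rfl⟩
  exact hS _ C (hC k le_rfl) x

/-- The extension of the Schwartz seminorm with weight `φ` and order `k` from `𝓞_M` to `X_k`. -/
noncomputable def lbSeminorm (φ : 𝓢(EuclideanSpace ℝ (Fin d), ℂ)) (k : ℕ) :
    Seminorm ℂ (LBSpace d k) :=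
  Seminorm.of (fun f => ⨆ x, ‖φ x‖ * ‖iteratedFDeriv ℝ k f.1 x‖)
    (by
      intro f g
      refine ciSup_le fun x => ?_
      obtain ⟨_, hf, -⟩ := f.2
      obtain ⟨_, hg, -⟩ := g.2
      have e : iteratedFDeriv ℝ k (f + g).1 x
          = iteratedFDeriv ℝ k f.1 x + iteratedFDeriv ℝ k g.1 x :=
        iteratedFDeriv_add_apply hf.contDiffAt hg.contDiffAt
      rw [e]
      refine (mul_le_mul_of_nonneg_left (norm_add_le _ _) (norm_nonneg _)).trans ?_
      rw [mul_add]
      exact add_le_add (le_ciSup (bddAbove_lbSeminorm φ f) x) (le_ciSup (bddAbove_lbSeminorm φ g) x))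
    (by
      intro c f
      rw [Real.mul_iSup_of_nonneg (norm_nonneg c)]
      refine iSup_congr fun x => ?_
      obtain ⟨_, hf, -⟩ := f.2
      have e : iteratedFDeriv ℝ k (c • f).1 x = c • iteratedFDeriv ℝ k f.1 x :=
        iteratedFDeriv_const_smul_apply hf.contDiffAt
      rw [e, norm_smul]
      ring)

/-- The extended Schwartz seminorms are continuous on `X_k`, since they are bounded on the unit
ball of every `X_{k,N}`. -/
lemma continuous_lbSeminorm (φ : 𝓢(EuclideanSpace ℝ (Fin d), ℂ)) (k : ℕ) :
    Continuous (lbSeminorm φ k) := by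
  let p : SeminormFamily ℂ (LBSpace d k) Unit := fun _ => lbSeminorm φ k
  let t : TopologicalSpace (LBSpace d k) := p.moduleFilterBasis.topology
  have ht : @WithSeminorms ℂ _ _ _ _ _ p t := @WithSeminorms.mk ℂ _ _ _ _ _ p t rfl
  have hcont : Continuous[t, inferInstance] (lbSeminorm φ k) :=
    WithSeminorms.continuous_seminorm (p := p) ht ()
  refine continuous_le_dom (sInf_le ⟨?_, ?_, ?_, fun N => ?_⟩) hcont
  · exact @WithSeminorms.topologicalAddGroup _ _ _ _ _ _ t p ht
  · exact @WithSeminorms.continuousSMul _ _ _ _ _ _ t p ht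
  · exact @WithSeminorms.toLocallyConvexSpace _ _ _ _ _ _ _ _ _ t p ht
  · obtain ⟨S, hS0, hS⟩ := exists_mul_norm_iteratedFDeriv_le φ k N
    refine WithSeminorms.continuous_of_isBounded (withSeminorms_stepNorm d k N) ht
      (stepInclusion d k N) (fun _ => ⟨{()}, ⟨S, hS0⟩, fun f => ?_⟩)
    rw [Finset.sup_singleton]
    exact ciSup_le fun x => hS f.1 _ (norm_iteratedFDeriv_le_stepNorm f le_rfl) x

/-! ### The topology of `𝓞_M` -/

lemma continuous_omInclusion (d n : ℕ) : Continuous (omInclusion d n) :=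
  continuous_iInf_dom (i := n) continuous_induced_dom

instance (d : ℕ) : IsTopologicalAddGroup (OM d) :=
  topologicalAddGroup_iInf fun n => topologicalAddGroup_induced (omInclusion d n)

lemma le_schwartzSeminorms (φ : 𝓢(EuclideanSpace ℝ (Fin d), ℂ)) (k : ℕ) (f : OM d)
    (x : EuclideanSpace ℝ (Fin d)) :
    ‖φ x‖ * ‖iteratedFDeriv ℝ k f.1 x‖ ≤ schwartzSeminorms d (φ, k) f :=
  le_ciSup (bddAbove_schwartzSeminorm φ k f) x

lemma setOf_forall_lt_one_mem (φ : 𝓢(EuclideanSpace ℝ (Fin d), ℂ)) (n : ℕ) :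
    {f : OM d | ∀ k ≤ n, schwartzSeminorms d (φ, k) f < 1}
      ∈ ⨅ i, Filter.comap (schwartzSeminorms d i) (𝓝 0) := by
  have h (k : ℕ) : {f : OM d | schwartzSeminorms d (φ, k) f < 1}
      ∈ ⨅ i, Filter.comap (schwartzSeminorms d i) (𝓝 0) := by
    refine Filter.mem_iInf_of_mem (φ, k) ?_
    exact Filter.preimage_mem_comap (m := schwartzSeminorms d (φ, k)) (Iio_mem_nhds one_pos)
  generalize (⨅ i, Filter.comap (schwartzSeminorms d i) (𝓝 0)) = l at h ⊢
  simpa only [Set.ofPred_forall, Set.mem_Iic] using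
    (Filter.biInter_mem (Set.finite_Iic n)).mpr fun k _ => h k

/-- A convex set containing a multiple of the trace of every unit ball of `X_{n,N}`, `N ∈ ℕ`, is a
neighbourhood of zero for the topology given by Schwartz's seminorms. -/
lemma mem_iInf_comap_schwartzSeminorms {V : Set (OM d)} (hconv : Convex ℝ V) {n : ℕ}
    (hV : ∀ N : ℕ, ∃ ε > 0, ∀ f : OM d,
      (∀ k ≤ n, ∀ x, ‖iteratedFDeriv ℝ k f.1 x‖ ≤ ε * bracket x ^ N) → f ∈ V) :
    V ∈ ⨅ i, Filter.comap (schwartzSeminorms d i) (𝓝 0) := by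
  obtain ⟨φ, hφ⟩ := exists_schwartzMap_of_absorbs hconv hV
  refine Filter.mem_of_superset (setOf_forall_lt_one_mem φ n) fun f hf => ?_
  have hf' : ∀ k ≤ n, schwartzSeminorms d (φ, k) f < 1 := hf
  exact hφ f fun k hk x => (le_schwartzSeminorms φ k f x).trans (hf' k hk).le

/-- The projective limit topology of `𝓞_M` is given by Schwartz's seminorms. -/
lemma withSeminorms_schwartzSeminorms (d : ℕ) : WithSeminorms (schwartzSeminorms d) := by
  rw [SeminormFamily.withSeminorms_iff_nhds_eq_iInf]
  refine le_antisymm (le_iInf fun i => ?_) ?_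
  · have hc : Continuous (schwartzSeminorms d i) := by
      have e : ⇑(schwartzSeminorms d i) = lbSeminorm i.1 i.2 ∘ omInclusion d i.2 :=
        funext fun _ => rfl
      rw [e]
      exact (continuous_lbSeminorm i.1 i.2).comp (continuous_omInclusion d i.2)
    rw [← Filter.tendsto_iff_comap]
    simpa using hc.tendsto 0
  · rw [nhds_iInf]
    refine le_iInf fun n => ?_
    rw [nhds_induced, map_zero]
    intro U hU
    obtain ⟨W, hW, hWU⟩ := Filter.mem_comap.mp hU
    obtain ⟨W', ⟨hW', hconv⟩, hW'W⟩ :=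
      (LocallyConvexSpace.convex_basis_zero ℝ (LBSpace d n)).mem_iff.mp hW
    refine Filter.mem_of_superset (mem_iInf_comap_schwartzSeminorms
      (V := (omInclusion d n) ⁻¹' W') ?_ (n := n) fun N => ?_)
      ((Set.preimage_mono hW'W).trans hWU)
    · exact hconv.linear_preimage ((omInclusion d n).restrictScalars ℝ)
    · obtain ⟨ε, hε, h⟩ := exists_of_mem_nhds_zero hW' N
      refine ⟨ε, hε, fun f hf => ?_⟩
      exact h ⟨f.1, f.contDiff n, ε, hf⟩ (stepNorm_le hf)

/-! ### Bornologicity -/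

lemma schwartzSeminorms_le {φ : 𝓢(EuclideanSpace ℝ (Fin d), ℂ)} {k : ℕ} {f : OM d} {C : ℝ}
    (h : ∀ x, ‖φ x‖ * ‖iteratedFDeriv ℝ k f.1 x‖ ≤ C) : schwartzSeminorms d (φ, k) f ≤ C :=
  ciSup_le h

lemma isVonNBounded_setOf_le (C : ℕ → ℝ) (A : ℕ → ℕ) :
    Bornology.IsVonNBounded ℂ
      {g : OM d | ∀ k x, ‖iteratedFDeriv ℝ k g.1 x‖ ≤ C k * bracket x ^ A k} := by
  rw [(withSeminorms_schwartzSeminorms d).isVonNBounded_iff_seminorm_bounded]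
  rintro ⟨φ, k⟩
  obtain ⟨S, -, hS⟩ := exists_mul_norm_iteratedFDeriv_le φ k (A k)
  refine ⟨|S * C k| + 1, by positivity, fun g hg => ?_⟩
  have := schwartzSeminorms_le (hS g.1 _ (hg k))
  linarith [le_abs_self (S * C k)]

/-- A sequence whose derivatives of order at most `n` are bounded by `5⟨x⟩` from the `n`-th term
on is bounded in `𝓞_M`. -/
lemma isVonNBounded_range {r : ℕ → OM d}
    (hr : ∀ n, ∀ k ≤ n, ∀ x, ‖iteratedFDeriv ℝ k (r n).1 x‖ ≤ 5 * bracket x) :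
    Bornology.IsVonNBounded ℂ (Set.range r) := by
  rw [(withSeminorms_schwartzSeminorms d).isVonNBounded_iff_seminorm_bounded]
  rintro ⟨φ, k⟩
  obtain ⟨S, -, hS⟩ := exists_mul_norm_iteratedFDeriv_le φ k 1
  have hb : BddAbove (Set.range fun n => schwartzSeminorms d (φ, k) (r n)) := by
    refine Filter.IsBoundedUnder.bddAbove_range ⟨S * 5, ?_⟩
    rw [Filter.eventually_map]
    filter_upwards [Filter.eventually_ge_atTop k] with n hn
    exact schwartzSeminorms_le (hS _ _ fun x => by simpa using hr n k hn x)
  obtain ⟨B, hB⟩ := hb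
  refine ⟨|B| + 1, by positivity, ?_⟩
  rintro _ ⟨n, rfl⟩
  have : schwartzSeminorms d (φ, k) (r n) ≤ B := hB (Set.mem_range_self n)
  linarith [le_abs_self B]

/-- A convex set which absorbs all bounded sets absorbs, for some `n`, the traces of the unit balls
of all `X_{n,N}`, `N ∈ ℕ`. Otherwise, for every `n` there is a function in the unit ball of
some `X_{n+1,N}` which is not absorbed well; splitting off a function from a bounded set leaves a
function `r n` of size `5⟨x⟩` together with its derivatives up to order `n`, which is not absorbed
well either. But the sequence `r` is bounded. -/
lemma exists_absorbs_of_absorbs_bounded {U : Set (OM d)} (hconv : Convex ℝ U)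
    (hU : ∀ B : Set (OM d), Bornology.IsVonNBounded ℂ B → Absorbs ℂ U B) :
    ∃ n, ∀ N : ℕ, ∃ ε > 0, ∀ f : OM d,
      (∀ k ≤ n, ∀ x, ‖iteratedFDeriv ℝ k f.1 x‖ ≤ ε * bracket x ^ N) → f ∈ U := by
  by_contra! hcon
  have hreal : ∀ B : Set (OM d), Bornology.IsVonNBounded ℂ B →
      ∃ s : ℝ, ∀ c : ℝ, 0 < c → s ≤ c → ∀ g ∈ B, ∃ u ∈ U, c • u = g := by
    intro B hB
    obtain ⟨s, -, hs⟩ := (hU B hB).exists_pos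
    refine ⟨s, fun c hc hsc g hg => ?_⟩
    obtain ⟨u, hu, hug⟩ := hs (c : ℂ) (by rwa [Complex.norm_real, Real.norm_of_nonneg hc.le]) hg
    refine ⟨u, hu, hug ▸ ?_⟩
    exact (algebraMap_smul ℂ c u).symm
  have hstep : ∀ n : ℕ, ∃ (r : OM d) (c : ℝ), 0 < c ∧ (n : ℝ) ≤ c ∧
      (∀ k ≤ n, ∀ x, ‖iteratedFDeriv ℝ k r.1 x‖ ≤ 5 * bracket x) ∧ ¬ ∃ u ∈ U, c • u = r := by
    intro n
    obtain ⟨N, hN⟩ := hcon (n + 1)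
    obtain ⟨C, A, hCA⟩ := exists_smooth_approx d n N
    obtain ⟨s, hs⟩ := hreal _ (isVonNBounded_setOf_le (d := d) C A)
    set c : ℝ := max s (n + 1)
    have hnc : (n : ℝ) + 1 ≤ c := le_max_right _ _
    have hc : 0 < c := by linarith [Nat.cast_nonneg (α := ℝ) n]
    obtain ⟨f, hf, hfU⟩ := hN (2 * c)⁻¹ (by positivity)
    obtain ⟨g, hg, hgb, hgr⟩ := hCA ((2 * c) • f).1 ((2 * c) • f).2.1 fun k hk x => by
      rw [iteratedFDeriv_real_smul, norm_smul, Real.norm_of_nonneg (by positivity)]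
      have := hf k hk x
      rwa [← div_eq_inv_mul, le_div_iff₀' (by positivity)] at this
    obtain ⟨u₁, hu₁, e₁⟩ := hs c hc (le_max_left _ _) (⟨g, hg⟩ : OM d) hgb
    let g' : OM d := ⟨g, hg⟩
    have hsub : ((2 * c) • f - g').1 = ((2 * c) • f).1 - g := rfl
    refine ⟨(2 * c) • f - g', c, hc, by linarith, by rwa [hsub], ?_⟩
    rintro ⟨u₂, hu₂, e₂⟩
    refine hfU ?_
    have h := hconv hu₁ hu₂ (a := 1 / 2) (b := 1 / 2) (by norm_num) (by norm_num) (by norm_num)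
    convert h using 1
    have e₃ : (2 * c) • f = c • u₁ + c • u₂ := by
      rw [e₁, e₂]; exact (add_sub_cancel g' _).symm
    have e₄ : f = (2 * c)⁻¹ • (c • u₁ + c • u₂) := by
      rw [← e₃, inv_smul_smul₀ (by positivity)]
    rw [e₄, smul_add, smul_smul, smul_smul, show (2 * c)⁻¹ * c = 1 / 2 by field_simp]
  choose r c hc hnc hr hrU using hstep
  obtain ⟨s, hs⟩ := hreal _ (isVonNBounded_range hr)
  obtain ⟨n, hn⟩ := exists_nat_ge s
  exact hrU n (hs (c n) (hc n) (hn.trans (hnc n)) (r n) (Set.mem_range_self n))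

end SlowlyIncreasing

/-- The natural topology of `𝓞_M(ℝ^d)`, that is, its topology as the projective limit of the
LB-spaces `X_n`, which is the topology given by Schwartz's seminorms, is bornological. -/
theorem mainTheorem1 (d : ℕ) :
    WithSeminorms (SlowlyIncreasing.schwartzSeminorms d) ∧
      IsBornologicalSpace (SlowlyIncreasing.OM d) := by
  have hW := SlowlyIncreasing.withSeminorms_schwartzSeminorms d
  refine ⟨hW, inferInstance, hW.continuousSMul, hW.toLocallyConvexSpace, fun U hconv _ hU => ?_⟩
  rw [(SlowlyIncreasing.schwartzSeminorms d).withSeminorms_iff_nhds_eq_iInf.mp hW]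
  obtain ⟨n, hn⟩ := SlowlyIncreasing.exists_absorbs_of_absorbs_bounded hconv hU
  exact SlowlyIncreasing.mem_iInf_comap_schwartzSeminorms hconv hn
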